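/- **Setting.** Let $n\ge 1$. On $\mathbb{R}^{2n}\ni z=(x,y)$ with the standard inner product let $J_0(x,y)=(-y,x)$, $\tau_0(x,y)=(x,-y)$ and $L_0=\mathrm{Fix}(\tau_0)=\{y=0\}$. Let $\mathbb{E}=E^{1/2}_{\tau_0}$ be the Hilbert space of all $x=\sum_{j\in\mathbb{Z}}e^{2\pi jtJ_0}x_j\in L^2(\mathbb{R}/\mathbb{Z};\mathbb{R}^{2n})$ with $x_j\in L_0$ and $\sum_j|j||x_j|^2<\infty$, with inner product $\langle x,y\rangle_{1/2}=\langle x_0,y_0\rangle+\sum_j|2\pi j|\langle x_j,y_j\rangle$. Let $\mathbb{E}=\mathbb{E}^-\oplus\mathbb{E}^0\oplus\mathbb{E}^+$, $x=x^-+x^0+x^+$, be the orthogonal splitting into the parts with $j<0$, $j=0$, $j>0$, and let $S^+$ be the unit sphere of $\mathbb{E}^+$. For $H:\mathbb{R}^{2n}\to[0,\infty)$ put $$\Phi_H(x)=\tfrac12\left(\|x^+\|_{1/2}^2-\|x^-\|_{1/2}^2\right)-\int_0^1H(x(t))\,dt,\qquad x\in\mathbb{E}.$$ Let $\Gamma$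 be the set of continuous maps $\gamma:\mathbb{E}\to\mathbb{E}$ for which there is a homotopy $(\gamma_u)_{0\le u\le1}$ with $\gamma_0=\mathrm{id}$, $\gamma_1=\gamma$, such that (i) $\gamma_u(\mathbb{E}\setminus(\mathbb{E}^-\oplus\mathbb{E}^0))=\mathbb{E}\setminus(\mathbb{E}^-\oplus\mathbb{E}^0)$ for all $u\in[0,1]$; (ii) $\gamma_u(x)=a(x,u)x^++b(x,u)x^0+c(x,u)x^-+K(x,u)$, where $(a,b,c,K):\mathbb{E}\times[0,1]\to(0,\infty)^3\times\mathbb{E}$ is continuous and maps bounded sets to relatively compact subsets of $(0,\infty)^3\times\mathbb{E}$. Put $$c_{\mathrm{EH},\tau_0}(H)=\sup_{\gamma\in\Gamma}\ \inf_{x\in\gamma(S^+)}\Phi_H(x)\in[-\infty,\infty].$$ **Theorem 3.1.** Let $H\in C^\infty(\mathbb{R}^{2n},\mathbb{R})$ with $H\ge0$ satisfy (H1) $H(z)=H(\tau_0z)$ for all $z\in\mathbb{R}^{2n}$; (H2) $\mathrm{Int}(H^{-1}(0))\cap L_0\neq\emptyset$; (H3) there are $z_0\in L_0$ and real numbers $a>2\pi$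 and $b$ such that $H(z)=a|z|^2+\langle z,z_0\rangle+b$ outside a compact subset of $\mathbb{R}^{2n}$; and let $H$ be nonresonant, that is, (H3) holds with some $a\notin\mathbb{Z}\pi$. Then $c_{\mathrm{EH},\tau_0}(H)$ is a (finite) positive critical value of $\Phi_H$ on $\mathbb{E}$: $0<c_{\mathrm{EH},\tau_0}(H)<\infty$, and there is $x\in\mathbb{E}$ at which $\Phi_H$ is Fréchet differentiable with $d\Phi_H(x)=0$ and $\Phi_H(x)=c_{\mathrm{EH},\tau_0}(H)$. -/

import Mathlib

open MeasureTheory Set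
open scoped ContDiff InnerProductSpace

noncomputable section

namespace SymEH

/-- `ℝ²ⁿ` with its standard inner product; `z (Sum.inl i)` is the coordinate `x_i` and
`z (Sum.inr i)` is the coordinate `y_i` of `z = (x, y)`. -/
abbrev Phase (n : ℕ) : Type := EuclideanSpace ℝ (Fin n ⊕ Fin n)

/-- The standard complex structure `J₀ (x, y) = (-y, x)`. -/
def J0 (n : ℕ) : Phase n →ₗ[ℝ] Phase n where
  toFun z := WithLp.toLp 2 (Sum.elim (fun i => -z (Sum.inr i)) (fun i => z (Sum.inl i)))
  map_add' z w := by
    ext i; rcases i with i | i <;> simp; ring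
  map_smul' r z := by
    ext i; rcases i with i | i <;> simp

/-- The canonical anti-symplectic involution `τ₀ (x, y) = (x, -y)`. -/
def tau0 (n : ℕ) : Phase n →ₗ[ℝ] Phase n where
  toFun z := WithLp.toLp 2 (Sum.elim (fun i => z (Sum.inl i)) (fun i => -z (Sum.inr i)))
  map_add' z w := by
    ext i; rcases i with i | i <;> simp; ring
  map_smul' r z := by
    ext i; rcases i with i | i <;> simp

/-- `L₀ = Fix τ₀`. -/
def L0 (n : ℕ) : Submodule ℝ (Phase n) := LinearMap.eqLocus (tau0 n) LinearMap.id

/-- The Hilbert space `L²(S¹; ℝ²ⁿ)`, where `S¹ = ℝ/ℤ` carries Lebesgue measure. -/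
abbrev L2Loop (n : ℕ) : Type := Lp (Phase n) 2 (volume : Measure UnitAddCircle)

/-- The rotation `e^{2πjtJ₀} = cos(2πjt) + sin(2πjt) J₀` of `ℝ²ⁿ`, for `t ∈ ℝ/ℤ`. -/
def rot (n : ℕ) (j : ℤ) (t : UnitAddCircle) (v : Phase n) : Phase n :=
  (fourier j t : ℂ).re • v + (fourier j t : ℂ).im • J0 n v

theorem continuous_rot (n : ℕ) (j : ℤ) (v : Phase n) : Continuous fun t => rot n j t v := by
  unfold rot
  have h : Continuous fun t : UnitAddCircle => (fourier j t : ℂ) := (fourier j).continuous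
  exact ((Complex.continuous_re.comp h).smul continuous_const).add
    ((Complex.continuous_im.comp h).smul continuous_const)

/-- The loop `t ↦ e^{2πjtJ₀} v` as an element of `L²(S¹; ℝ²ⁿ)`. -/
def mode (n : ℕ) (j : ℤ) : Phase n →ₗ[ℝ] L2Loop n where
  toFun v := ContinuousMap.toLp 2 volume ℝ ⟨fun t => rot n j t v, continuous_rot n j v⟩
  map_add' v w := by
    rw [← map_add]; congr 1; ext1 t; simp [rot]; abel
  map_smul' r v := by
    rw [← map_smul]; congr 1; ext1 t; simp [rot, smul_comm r]

/-- The `j`-th coefficient `x_j = ∫₀¹ e^{-2πjtJ₀} x(t) dt` of `x ∈ L²(S¹; ℝ²ⁿ)`. -/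
def coeff {n : ℕ} (x : L2Loop n) (j : ℤ) : Phase n := ∫ t, rot n (-j) t (x t)

theorem inner_J0_left {n : ℕ} (v w : Phase n) : ⟪J0 n v, w⟫_ℝ = -⟪v, J0 n w⟫_ℝ := by
  simp only [PiLp.inner_apply, Fintype.sum_sum_type, J0, LinearMap.coe_mk, AddHom.coe_mk,
    Sum.elim_inl, Sum.elim_inr, neg_add, ← Finset.sum_neg_distrib]
  rw [add_comm]
  simp

theorem inner_rot {n : ℕ} (j : ℤ) (t : UnitAddCircle) (v w : Phase n) :
    ⟪v, rot n (-j) t w⟫_ℝ = ⟪rot n j t v, w⟫_ℝ := by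
  simp only [rot, fourier_neg, inner_add_left, inner_add_right, inner_smul_left,
    inner_smul_right, inner_J0_left, Complex.conj_re, Complex.conj_im]
  simp

theorem J0_J0 {n : ℕ} (v : Phase n) : J0 n (J0 n v) = -v := by
  ext i; rcases i with i | i <;> simp [J0]

theorem rot_rot {n : ℕ} (j k : ℤ) (t : UnitAddCircle) (v : Phase n) :
    rot n j t (rot n k t v) = rot n (j + k) t v := by
  simp only [rot, fourier_add, map_add, map_smul, J0_J0, Complex.mul_re, Complex.mul_im]
  module

theorem integrable_rot {n : ℕ} (x : L2Loop n) (j : ℤ) :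
    Integrable (fun t => rot n j t (x t)) volume := by
  have hx : Integrable (x : UnitAddCircle → Phase n) volume :=
    (Lp.memLp x).integrable (by norm_num)
  have hc : Continuous fun t : UnitAddCircle => (fourier j t : ℂ) := (fourier j).continuous
  have hJ : Integrable (fun t => J0 n (x t)) volume :=
    (LinearMap.toContinuousLinearMap (J0 n)).integrable_comp hx
  have hn : ∀ t : UnitAddCircle, ‖(fourier j t : ℂ)‖ ≤ 1 := fun t => by
    rw [fourier_apply]; exact (Circle.norm_coe _).le
  unfold rot
  refine Integrable.add ?_ ?_
  · refine hx.bdd_smul (φ := fun t : UnitAddCircle => (fourier j t : ℂ).re) 1 (Complex.continuous_re.comp hc).aestronglyMeasurable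
      (Filter.Eventually.of_forall fun t => (Complex.abs_re_le_norm _).trans (hn t))
  · refine hJ.bdd_smul (φ := fun t : UnitAddCircle => (fourier j t : ℂ).im) 1 (Complex.continuous_im.comp hc).aestronglyMeasurable
      (Filter.Eventually.of_forall fun t => (Complex.abs_im_le_norm _).trans (hn t))

theorem mode_coeFn (n : ℕ) (j : ℤ) (v : Phase n) :
    (mode n j v : UnitAddCircle → Phase n) =ᵐ[volume] fun t => rot n j t v :=
  ContinuousMap.coeFn_toLp (𝕜 := ℝ) volume
    (⟨fun t => rot n j t v, continuous_rot n j v⟩ : C(UnitAddCircle, Phase n))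

theorem inner_coeff {n : ℕ} (x : L2Loop n) (j : ℤ) (v : Phase n) :
    ⟪v, coeff x j⟫_ℝ = ⟪mode n j v, x⟫_ℝ := by
  rw [coeff, ← integral_inner (integrable_rot x (-j)), L2.inner_def]
  refine integral_congr_ae ?_
  filter_upwards [mode_coeFn n j v] with t ht
  rw [ht, inner_rot]

theorem integral_fourier (j : ℤ) :
    ∫ t : UnitAddCircle, (fourier j t : ℂ) = if j = 0 then 1 else 0 := by
  have h := fourierCoeff_fourier (T := (1 : ℝ)) j
  have h0 := congrFun h 0
  rw [fourierCoeff, AddCircle.integral_haarAddCircle] at h0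
  simp only [neg_zero, fourier_zero, one_smul, inv_one] at h0
  refine h0.trans ?_
  by_cases hj : j = 0
  · subst hj; simp
  · rw [if_neg hj, Pi.single_eq_of_ne (fun h => hj h.symm)]

theorem coeff_mode {n : ℕ} (j k : ℤ) (v : Phase n) :
    coeff (mode n k v) j = if k = j then v else 0 := by
  have h1 : coeff (mode n k v) j = ∫ t, rot n (-j + k) t v := by
    refine integral_congr_ae ?_
    filter_upwards [mode_coeFn n k v] with t ht
    rw [ht, rot_rot]
  have hF : Integrable (fun t : UnitAddCircle => (fourier (-j + k) t : ℂ)) volume :=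
    (fourier (-j + k)).continuous.integrable_of_hasCompactSupport
      (HasCompactSupport.of_compactSpace _)
  rw [h1]
  simp only [rot]
  have e1 : ∫ t : UnitAddCircle, (fourier (-j + k) t : ℂ).re
      = (∫ t : UnitAddCircle, (fourier (-j + k) t : ℂ)).re :=
    integral_re (𝕜 := ℂ) hF
  have e2 : ∫ t : UnitAddCircle, (fourier (-j + k) t : ℂ).im
      = (∫ t : UnitAddCircle, (fourier (-j + k) t : ℂ)).im :=
    integral_im (𝕜 := ℂ) hF
  have i1 : Integrable (fun t : UnitAddCircle => (fourier (-j + k) t : ℂ).re) volume := hF.re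
  have i2 : Integrable (fun t : UnitAddCircle => (fourier (-j + k) t : ℂ).im) volume := hF.im
  rw [integral_add (i1.smul_const _) (i2.smul_const _), integral_smul_const,
    integral_smul_const, e1, e2, integral_fourier]
  by_cases hkj : k = j
  · subst hkj; simp
  · have : -j + k ≠ 0 := fun h => hkj (by omega)
    simp [hkj, this]

/-- The coefficients of a series `∑ e^{2πjtJ₀} c_j` converging in `L²` are the `c_j`. -/
theorem coeff_eq_of_hasSum {n : ℕ} {x : L2Loop n} {c : ℤ → Phase n}
    (h : HasSum (fun j => mode n j (c j)) x) : coeff x = c := by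
  funext j
  refine ext_inner_left ℝ fun v => ?_
  rw [inner_coeff]
  have h1 : HasSum (fun k => ⟪mode n j v, mode n k (c k)⟫_ℝ) ⟪mode n j v, x⟫_ℝ :=
    h.mapL (innerSL ℝ (mode n j v))
  refine h1.unique ?_
  have h2 : (fun k => ⟪mode n j v, mode n k (c k)⟫_ℝ) = fun k => if k = j then ⟪v, c j⟫_ℝ else 0 := by
    funext k
    rw [← inner_coeff, coeff_mode]
    by_cases hk : k = j
    · subst hk; simp
    · simp [hk]
  rw [h2]
  exact hasSum_ite_eq j _

theorem coeff_add {n : ℕ} (x y : L2Loop n) (j : ℤ) :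
    coeff (x + y) j = coeff x j + coeff y j := by
  refine ext_inner_left ℝ fun v => ?_
  simp only [inner_add_right, inner_coeff]

theorem coeff_smul {n : ℕ} (r : ℝ) (x : L2Loop n) (j : ℤ) :
    coeff (r • x) j = r • coeff x j := by
  refine ext_inner_left ℝ fun v => ?_
  simp only [inner_smul_right, inner_coeff]

/-- The set `E^{1/2}_{τ₀}` of all `x = ∑_j e^{2πjtJ₀} x_j` in `L²(S¹; ℝ²ⁿ)` with `x_j ∈ L₀` and
`∑_j |j| |x_j|² < ∞`, as a linear subspace of `L²(S¹; ℝ²ⁿ)`. -/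
def loopSubmodule (n : ℕ) : Submodule ℝ (L2Loop n) where
  carrier := {x | ∃ c : ℤ → Phase n, (∀ j, c j ∈ L0 n) ∧
    Summable (fun j : ℤ => |(j : ℝ)| * ‖c j‖ ^ 2) ∧ HasSum (fun j => mode n j (c j)) x}
  zero_mem' := ⟨0, by simp, by simp, by simp⟩
  add_mem' := by
    rintro x y ⟨c, hc, hcs, hcx⟩ ⟨d, hd, hds, hdy⟩
    refine ⟨c + d, fun j => (L0 n).add_mem (hc j) (hd j), ?_, ?_⟩
    · refine Summable.of_nonneg_of_le (fun j => by positivity) (fun j => ?_)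
        ((hcs.mul_left 2).add (hds.mul_left 2))
      have h1 : ‖(c + d) j‖ ^ 2 ≤ 2 * ‖c j‖ ^ 2 + 2 * ‖d j‖ ^ 2 := by
        have := norm_add_le (c j) (d j)
        have h0 := norm_nonneg (c j + d j)
        simp only [Pi.add_apply]
        nlinarith [sq_nonneg (‖c j‖ - ‖d j‖)]
      nlinarith [mul_le_mul_of_nonneg_left h1 (abs_nonneg (j : ℝ))]
    · simpa using hcx.add hdy
  smul_mem' := by
    rintro r x ⟨c, hc, hcs, hcx⟩
    refine ⟨r • c, fun j => (L0 n).smul_mem r (hc j), ?_, ?_⟩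
    · refine (hcs.mul_left (r ^ 2)).congr fun j => ?_
      simp only [Pi.smul_apply, norm_smul, mul_pow, Real.norm_eq_abs, sq_abs]
      ring
    · simpa using hcx.const_smul r

/-- The space `𝔼 = E^{1/2}_{τ₀}`. It is a type of its own because it carries the norm
`‖·‖_{1/2}` and not the norm of `L²`. -/
def E (n : ℕ) : Type := loopSubmodule n

namespace E

variable {n : ℕ}

instance : AddCommGroup (E n) := inferInstanceAs (AddCommGroup (loopSubmodule n))

instance : Module ℝ (E n) := inferInstanceAs (Module ℝ (loopSubmodule n))

/-- The inclusion `𝔼 ⊆ L²(S¹; ℝ²ⁿ)`. -/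
def toL2 : E n →ₗ[ℝ] L2Loop n := (loopSubmodule n).subtype

theorem toL2_injective : Function.Injective (toL2 : E n → L2Loop n) := Subtype.val_injective

/-- The coefficient `x_j` in `x = ∑_j e^{2πjtJ₀} x_j`. -/
def coef (x : E n) (j : ℤ) : Phase n := coeff (toL2 x) j

theorem coef_add (x y : E n) (j : ℤ) : (x + y).coef j = x.coef j + y.coef j := by
  rw [coef, map_add, coeff_add]; rfl

theorem coef_smul (r : ℝ) (x : E n) (j : ℤ) : (r • x).coef j = r • x.coef j := by
  rw [coef, map_smul, coeff_smul]; rfl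

theorem coef_spec (x : E n) : (∀ j, x.coef j ∈ L0 n) ∧
    Summable (fun j : ℤ => |(j : ℝ)| * ‖x.coef j‖ ^ 2) ∧
    HasSum (fun j => mode n j (x.coef j)) (toL2 x) := by
  obtain ⟨c, h1, h2, h3⟩ := x.2
  have h : x.coef = c := coeff_eq_of_hasSum h3
  rw [h]
  exact ⟨h1, h2, h3⟩

theorem summable_inner (x y : E n) :
    Summable fun j : ℤ => |2 * Real.pi * (j : ℝ)| * ⟪x.coef j, y.coef j⟫_ℝ := by
  have h := ((x.coef_spec.2.1.add y.coef_spec.2.1).mul_left (2 * Real.pi))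
  refine Summable.of_norm_bounded h fun j => ?_
  have h1 := abs_real_inner_le_norm (x.coef j) (y.coef j)
  have h2 : |⟪x.coef j, y.coef j⟫_ℝ| ≤ ‖x.coef j‖ ^ 2 + ‖y.coef j‖ ^ 2 := by
    nlinarith [sq_nonneg (‖x.coef j‖ - ‖y.coef j‖), sq_nonneg ‖x.coef j‖, sq_nonneg ‖y.coef j‖]
  rw [Real.norm_eq_abs, abs_mul, abs_abs, abs_mul, abs_of_pos Real.two_pi_pos]
  have := mul_le_mul_of_nonneg_left h2
    (mul_nonneg Real.two_pi_pos.le (abs_nonneg (j : ℝ)))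
  linarith

/-- The inner product `⟨x, y⟩_{1/2} = ⟨x_0, y_0⟩ + ∑_j |2πj| ⟨x_j, y_j⟩`. -/
abbrev innerCore : InnerProductSpace.Core ℝ (E n) where
  inner x y := ⟪x.coef 0, y.coef 0⟫_ℝ +
    ∑' j : ℤ, |2 * Real.pi * (j : ℝ)| * ⟪x.coef j, y.coef j⟫_ℝ
  conj_inner_symm x y := by
    simp only [conj_trivial, real_inner_comm]
  re_inner_nonneg x := by
    simp only [RCLike.re_to_real]
    exact add_nonneg real_inner_self_nonneg
      (tsum_nonneg fun j => mul_nonneg (abs_nonneg _) real_inner_self_nonneg)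
  add_left x y z := by
    simp only [coef_add, inner_add_left, mul_add]
    rw [(summable_inner x z).tsum_add (summable_inner y z)]
    ring
  smul_left x y r := by
    simp only [coef_smul, real_inner_smul_left, conj_trivial]
    rw [mul_add, ← tsum_mul_left]
    congr 1
    exact tsum_congr fun j => by ring
  definite x hx := by
    have h0 : 0 ≤ ⟪x.coef 0, x.coef 0⟫_ℝ := real_inner_self_nonneg
    have hj : ∀ j : ℤ, 0 ≤ |2 * Real.pi * (j : ℝ)| * ⟪x.coef j, x.coef j⟫_ℝ :=
      fun j => mul_nonneg (abs_nonneg _) real_inner_self_nonneg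
    have hs : 0 ≤ ∑' j : ℤ, |2 * Real.pi * (j : ℝ)| * ⟪x.coef j, x.coef j⟫_ℝ := tsum_nonneg hj
    have hz : ∀ j : ℤ, x.coef j = 0 := by
      intro j
      by_cases hj0 : j = 0
      · subst hj0
        exact inner_self_eq_zero.1 (le_antisymm (by linarith) h0)
      · have ht := (summable_inner x x).le_tsum j (fun k _ => hj k)
        have h1 : |2 * Real.pi * (j : ℝ)| * ⟪x.coef j, x.coef j⟫_ℝ = 0 :=
          le_antisymm (by linarith) (hj j)
        rcases mul_eq_zero.1 h1 with h2 | h2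
        · exfalso
          have : (j : ℝ) ≠ 0 := by exact_mod_cast hj0
          simp [Real.pi_ne_zero, this] at h2
        · exact inner_self_eq_zero.1 h2
    have h3 := x.coef_spec.2.2
    simp only [hz, map_zero] at h3
    refine toL2_injective ?_
    rw [map_zero]
    exact h3.unique hasSum_zero

instance : NormedAddCommGroup (E n) := 
  @InnerProductSpace.Core.toNormedAddCommGroup ℝ (E n) _ _ _ innerCore

instance : InnerProductSpace ℝ (E n) := InnerProductSpace.ofCore innerCore.toCore

/-- For `x = ∑_j e^{2πjtJ₀} x_j`, the partial series over the `j` in `A`. -/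
def part (A : Set ℤ) (x : E n) : E n :=
  ⟨∑' j : ℤ, mode n j (A.indicator x.coef j), A.indicator x.coef, by
    intro j
    by_cases hj : j ∈ A
    · simpa [hj] using x.coef_spec.1 j
    · simp [hj], by
    refine Summable.of_nonneg_of_le (fun j => by positivity) (fun j => ?_) x.coef_spec.2.1
    by_cases hj : j ∈ A
    · simp [hj]
    · rw [indicator_of_notMem hj, norm_zero, zero_pow two_ne_zero, mul_zero]
      positivity, by
    refine Summable.hasSum ?_
    refine (x.coef_spec.2.2.summable.indicator A).congr fun j => ?_
    by_cases hj : j ∈ A <;> simp [hj]⟩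

/-- The component `x⁺` of `x` in `𝔼⁺`. -/
def plus (x : E n) : E n := x.part {j | 0 < j}

/-- The component `x⁰` of `x` in `𝔼⁰`. -/
def zero (x : E n) : E n := x.part {0}

/-- The component `x⁻` of `x` in `𝔼⁻`. -/
def minus (x : E n) : E n := x.part {j | j < 0}

/-- The elements `x` of `𝔼` with `x_j = 0` for all `j` outside of `A`. -/
def supportedOn (n : ℕ) (A : Set ℤ) : Submodule ℝ (E n) where
  carrier := {x | ∀ j, j ∉ A → x.coef j = 0}
  zero_mem' j _ := by simpa using coef_smul (0 : ℝ) (0 : E n) j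
  add_mem' hx hy j hj := by rw [coef_add, hx j hj, hy j hj, add_zero]
  smul_mem' r x hx j hj := by rw [coef_smul, hx j hj, smul_zero]

end E

/-- `𝔼⁺`. -/
def Eplus (n : ℕ) : Submodule ℝ (E n) := E.supportedOn n {j | 0 < j}

/-- `𝔼⁰`, the constant loops with value in `L₀`. -/
def Ezero (n : ℕ) : Submodule ℝ (E n) := E.supportedOn n {0}

/-- `𝔼⁻`. -/
def Eminus (n : ℕ) : Submodule ℝ (E n) := E.supportedOn n {j | j < 0}

/-- The unit sphere `S⁺` of `𝔼⁺`. -/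
def Splus (n : ℕ) : Set (E n) := {x | x ∈ Eplus n ∧ ‖x‖ = 1}

/-- The action functional `Φ_H(x) = ½ (‖x⁺‖² - ‖x⁻‖²) - ∫₀¹ H(x(t)) dt` on `𝔼`. -/
def action {n : ℕ} (H : Phase n → ℝ) (x : E n) : ℝ :=
  (1 / 2) * (‖x.plus‖ ^ 2 - ‖x.minus‖ ^ 2) - ∫ t : UnitAddCircle, H (x.toL2 t)

/-- `γ` is an admissible deformation of `𝔼`: there is a homotopy `G u`, `0 ≤ u ≤ 1`, from the
identity to `γ` such that every `G u` maps `𝔼 \ (𝔼⁻ ⊕ 𝔼⁰)` onto itself, and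
`G u x = a(x,u) x⁺ + b(x,u) x⁰ + c(x,u) x⁻ + K(x,u)` for a continuous map
`(a, b, c, K) : 𝔼 × [0,1] → (0,∞)³ × 𝔼` that maps bounded sets to relatively compact sets
(relatively compact in `(0,∞)³ × 𝔼`, so that `a`, `b`, `c` stay away from `0` and `∞`
on bounded sets). -/
def IsAdmissible {n : ℕ} (γ : E n → E n) : Prop :=
  Continuous γ ∧ ∃ G : unitInterval → E n → E n,
    (Continuous fun p : E n × unitInterval => G p.2 p.1) ∧
    G 0 = id ∧ G 1 = γ ∧
    (∀ u, G u '' ((Eminus n ⊔ Ezero n : Submodule ℝ (E n)) : Set (E n))ᶜ =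
      ((Eminus n ⊔ Ezero n : Submodule ℝ (E n)) : Set (E n))ᶜ) ∧
    ∃ (a b c : E n × unitInterval → Ioi (0 : ℝ)) (K : E n × unitInterval → E n),
      Continuous (fun p => (a p, b p, c p, K p)) ∧
      (∀ B : Set (E n × unitInterval), Bornology.IsBounded B →
        IsCompact (closure ((fun p => (a p, b p, c p, K p)) '' B))) ∧
      ∀ x u, G u x = (a (x, u) : ℝ) • x.plus + (b (x, u) : ℝ) • x.zero
        + (c (x, u) : ℝ) • x.minus + K (x, u)

/-- `c_{EH,τ₀}(H) = sup_{γ ∈ Γ} inf_{x ∈ γ(S⁺)} Φ_H(x)`, with `Γ` the set of all admissible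
deformations; supremum and infimum are taken in `[-∞, ∞]`. -/
def cEH {n : ℕ} (H : Phase n → ℝ) : EReal :=
  ⨆ γ ∈ {γ : E n → E n | IsAdmissible γ}, ⨅ x ∈ γ '' Splus n, (action H x : EReal)

/-- `H(z) = a|z|² + ⟨z, z₀⟩ + b` outside of a compact set. -/
def EqQuadraticOutsideCompact {n : ℕ} (H : Phase n → ℝ) (z₀ : Phase n) (a b : ℝ) : Prop :=
  ∃ C : Set (Phase n), IsCompact C ∧ ∀ z ∉ C, H z = a * ‖z‖ ^ 2 + ⟪z, z₀⟫_ℝ + b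

/-- `H` is quadratic at infinity: outside of a compact set `H(z) = a|z|² + ⟨z, z₀⟩ + b` with
`z₀ ∈ L₀`, `a > 2π` and `b ∈ ℝ`. -/
def QuadraticAtInfinity {n : ℕ} (H : Phase n → ℝ) : Prop :=
  ∃ z₀ ∈ L0 n, ∃ a b : ℝ, 2 * Real.pi < a ∧ EqQuadraticOutsideCompact H z₀ a b

/-- `H` is nonresonant: it is quadratic at infinity with an `a` that is not an integer
multiple of `π`. -/
def Nonresonant {n : ℕ} (H : Phase n → ℝ) : Prop :=
  ∃ z₀ ∈ L0 n, ∃ a b : ℝ, 2 * Real.pi < a ∧ (∀ k : ℤ, a ≠ k * Real.pi) ∧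
    EqQuadraticOutsideCompact H z₀ a b

/-- `c` is a critical value of `Φ_H`: there is `x ∈ 𝔼` at which `Φ_H` is (Fréchet)
differentiable with derivative zero and `Φ_H(x) = c`. -/
def IsCriticalValue {n : ℕ} (H : Phase n → ℝ) (c : ℝ) : Prop :=
  ∃ x : E n, HasFDerivAt (action H) (0 : E n →L[ℝ] ℝ) x ∧ action H x = c

end SymEH

end

namespace SymEH

/-! ### Brouwer-type theorem in finite dimensions, by integrating Jacobians -/

section Brouwer

open Metric Filter Topology
open scoped NNReal

/-! The value is a minimax over a class of maps closed under composition. It therefore suffices to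
bound it between positive reals and to show that a positive level which is not critical can be
raised.

Lower bound: near a point `z` of `L₀` where `H` vanishes locally, take the admissible map `x ↦ ε x +
z`. On `S⁺` its quadratic action is `ε²/2`, while `∫ H(z + ε x)` is at most `ε²/4` for small `ε`
(`exists_integral_add_smul_le`). Loops in `𝔼` need not be bounded, so this estimate splits off
finitely many modes, which are bounded pointwise, from a tail that is small in `L²`.

Upper bound: every admissible image of `S⁺` meets `𝔼⁻ ⊕ 𝔼⁰ ⊕ ℝ_{≥0} e`, where `e` lies in the first
mode (`IsAdmissible.exists_plus_eq_smul`). There `Φ_H` is bounded above because `H ≥ 2π|z|² - C`.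
The intersection is found on finitely many modes by a Brouwer-type theorem and passes to the limit
by the compactness in the definition of admissibility.

Criticality: since `a` is not a multiple of `π`, the linearisation at infinity `quadraticGrad` is
bounded below. The gradient of `Φ_H` differs from it by a map with relatively compact range, which
gives the Palais–Smale condition (`exists_le_norm_gradAction`). If `c > 0` were not critical, the
gradient would be bounded below near level `c`. In place of a flow, a single explicit Euler step `x
+ s χ(x) ∇Φ_H(x)` is used, with `χ(x) = ‖x⁺‖ / (1 + ‖x‖)`. The field `χ ∇Φ_H` is globally Lipschitz,
so for small `s` the step is a bijection; it fixes `𝔼⁻ ⊕ 𝔼⁰` and is admissible, because `∇Φ_H(x) =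
x⁺ - x⁻ -` (compact). It raises `Φ_H` by a definite amount near level `c`, since `χ` is bounded
below where `Φ_H` is at least a positive constant. Composing it with a nearly optimal admissible map
exceeds the supremum. -/

/-- Solving `x + g x = y` means finding a fixed point of the contraction `x ↦ y - g x`. This serves
both the change of variables below and the Euler step of the gradient. -/
theorem bijective_id_add_of_lipschitz {X : Type*} [NormedAddCommGroup X] [CompleteSpace X]
    {g : X → X} {c : ℝ≥0} (hc : c < 1) (hg : LipschitzWith c g) :
    Function.Bijective fun x => x + g x := by
  constructor
  · intro x y hxy
    have h1 : x - y = g y - g x := by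
      have : x + g x = y + g y := hxy
      rw [sub_eq_sub_iff_add_eq_add, this, add_comm]
    have h2 := hg.dist_le_mul y x
    rw [dist_eq_norm, ← h1, dist_comm, dist_eq_norm] at h2
    have h3 : (c : ℝ) < 1 := by exact_mod_cast hc
    have h4 : ‖x - y‖ = 0 := by nlinarith [norm_nonneg (x - y)]
    exact sub_eq_zero.1 (norm_eq_zero.1 h4)
  · intro y
    have hK : ContractingWith c fun x => y - g x :=
      ⟨hc, LipschitzWith.of_dist_le_mul fun a b => by
        rw [dist_sub_left]; exact hg.dist_le_mul a b⟩
    refine ⟨hK.fixedPoint, ?_⟩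
    have h := hK.fixedPoint_isFixedPt
    have h' : y - g hK.fixedPoint = hK.fixedPoint := h
    change hK.fixedPoint + g hK.fixedPoint = y
    nth_rewrite 1 [← h']
    abel

variable {V : Type*} [NormedAddCommGroup V] [InnerProductSpace ℝ V] [FiniteDimensional ℝ V]

open Polynomial in
-- The function `t ↦ det (1 + t A)` is a polynomial of degree at most `dim V`, so its value at `1`
-- is interpolated from more than `dim V` nodes, which may be as small as desired.
theorem det_one_add_eq_sum_lagrange (A : V →ₗ[ℝ] V) (s : Finset ℝ)
    (hs : Module.finrank ℝ V < s.card) :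
    LinearMap.det (1 + A) =
      ∑ t ∈ s, (Lagrange.basis s id t).eval 1 * LinearMap.det (1 + t • A) := by
  classical
  let b := Module.finBasis ℝ V
  let M := LinearMap.toMatrix b b A
  let p : ℝ[X] := Matrix.det ((X : ℝ[X]) • M.map C + (1 : Matrix _ _ ℝ).map C)
  have hp : ∀ t : ℝ, p.eval t = LinearMap.det (1 + t • A) := by
    intro t
    rw [← LinearMap.det_toMatrix b]
    simp only [p]
    rw [← coe_evalRingHom, RingHom.map_det]
    congr 1
    ext i j
    by_cases hij : i = j
    · simp [M, LinearMap.toMatrix_one, hij, add_comm, mul_comm t]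
    · simp [M, LinearMap.toMatrix_one, hij, mul_comm t]
  have hdeg : p.degree < s.card := by
    refine lt_of_le_of_lt degree_le_natDegree ?_
    have h := natDegree_det_X_add_C_le M 1
    rw [Fintype.card_fin] at h
    exact_mod_cast h.trans_lt hs
  have h1 := Lagrange.eq_interpolate (s := s) (v := id) (Function.injective_id.injOn) hdeg
  have h2 := congrArg (Polynomial.eval 1) h1
  rw [Lagrange.interpolate_apply, eval_finsetSum] at h2
  have h3 := hp 1
  rw [one_smul] at h3
  rw [← h3, h2]
  refine Finset.sum_congr rfl fun t _ => ?_
  rw [eval_mul, eval_C, id, hp, mul_comm]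

/-- By the Neumann series the determinant does not vanish on `[0, t]`, and it is `1` at `0`; the
intermediate value theorem fixes its sign. -/
theorem det_one_add_smul_pos {A : V →L[ℝ] V} {t : ℝ} (ht : 0 ≤ t) (htA : t * ‖A‖ < 1) :
    0 < (1 + t • A).det := by
  have hne : ∀ s ∈ Icc (0 : ℝ) t, (1 + s • A).det ≠ 0 := by
    intro s hs h0
    have hu : IsUnit (1 - (-(s • A))) := by
      refine isUnit_one_sub_of_norm_lt_one ?_
      rw [norm_neg, norm_smul, Real.norm_of_nonneg hs.1]
      exact (mul_le_mul_of_nonneg_right hs.2 (norm_nonneg _)).trans_lt htA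
    rw [sub_neg_eq_add] at hu
    obtain ⟨B, hB⟩ := hu.exists_right_inv
    have h1 : (1 + s • A).det * B.det = 1 := by
      have h2 : (((1 + s • A : V →L[ℝ] V) : V →ₗ[ℝ] V) * (B : V →ₗ[ℝ] V)) = 1 := by
        ext x
        exact congrArg (fun T : V →L[ℝ] V => T x) hB
      have h3 := congrArg LinearMap.det h2
      rwa [map_mul, map_one] at h3
    rw [h0, zero_mul] at h1
    exact zero_ne_one h1
  have hc : ContinuousOn (fun s : ℝ => (1 + s • A).det) (Icc 0 t) :=
    (ContinuousLinearMap.continuous_det.comp (by fun_prop)).continuousOn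
  by_contra hneg
  have h0 : (1 + (0 : ℝ) • A).det = 1 := by
    simp [ContinuousLinearMap.det]
  have hm : (0 : ℝ) ∈ Icc ((1 + t • A).det) ((1 + (0 : ℝ) • A).det) :=
    ⟨not_lt.1 hneg, by rw [h0]; norm_num⟩
  obtain ⟨s, hs, hs0⟩ := intermediate_value_Icc' ht hc hm
  exact hne s hs hs0

/-- For `t L < 1` the map `x + t g x` is a bijection of `V` that is the identity off the ball, hence
maps the ball onto itself. Its Jacobian is positive, so the change of variables formula gives the
volume. -/
theorem integral_det_one_add_smul [MeasurableSpace V] [BorelSpace V]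
    (μ : Measure V) [μ.IsAddHaarMeasure] {g : V → V} {L : ℝ≥0}
    (hg : LipschitzWith L g) {R : ℝ} (hR : ∀ x, R ≤ ‖x‖ → g x = 0)
    (hd : ∀ x ∈ ball (0 : V) R, HasFDerivAt g (fderiv ℝ g x) x)
    (hc : ContinuousOn (fderiv ℝ g) (ball (0 : V) R))
    {t : ℝ} (ht : 0 ≤ t) (htL : t * L < 1) :
    ∫ x in ball (0 : V) R, (1 + t • fderiv ℝ g x).det ∂μ = μ.real (ball (0 : V) R) := by
  have hLip : LipschitzWith (t.toNNReal * L) fun x => t • g x :=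
    LipschitzWith.of_dist_le_mul fun x y => by
      rw [dist_smul₀, Real.norm_of_nonneg ht, NNReal.coe_mul, Real.coe_toNNReal _ ht, mul_assoc]
      exact mul_le_mul_of_nonneg_left (hg.dist_le_mul x y) ht
  have hbij := bijective_id_add_of_lipschitz (g := fun x => t • g x) (c := t.toNNReal * L)
    (by rw [← NNReal.coe_lt_coe]; simpa [Real.coe_toNNReal _ ht] using htL) hLip
  have himg : (fun x => x + t • g x) '' ball (0 : V) R = ball (0 : V) R := by
    have hout : ∀ x, R ≤ ‖x‖ → x + t • g x = x := fun x hx => by rw [hR x hx]; simp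
    ext y
    constructor
    · rintro ⟨x, hx, rfl⟩
      by_contra hy
      rw [mem_ball_zero_iff, not_lt] at hy
      have h1 := hout _ hy
      have h2 : x + t • g x = x := hbij.1 h1
      rw [mem_ball_zero_iff] at hx
      simp only [h2] at hy
      linarith
    · intro hy
      obtain ⟨x, rfl⟩ := hbij.2 y
      refine ⟨x, ?_, rfl⟩
      by_contra hx
      rw [mem_ball_zero_iff, not_lt] at hx
      have h1 := hout x hx
      change x + t • g x ∈ _ at hy
      rw [h1, mem_ball_zero_iff] at hy
      linarith
  have hpos : ∀ x ∈ ball (0 : V) R, 0 < (1 + t • fderiv ℝ g x).det := fun x _ =>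
    det_one_add_smul_pos ht ((mul_le_mul_of_nonneg_left
      (norm_fderiv_le_of_lipschitz ℝ hg) ht).trans_lt htL)
  have hder : ∀ x ∈ ball (0 : V) R, HasFDerivWithinAt (fun x => x + t • g x)
      (1 + t • fderiv ℝ g x) (ball (0 : V) R) x := fun x hx =>
    ((hasFDerivAt_id x).add ((hd x hx).const_smul t)).hasFDerivWithinAt
  have hcov := lintegral_abs_det_fderiv_eq_addHaar_image μ measurableSet_ball hder
    hbij.1.injOn
  rw [himg] at hcov
  have hmeas : AEStronglyMeasurable (fun x => (1 + t • fderiv ℝ g x).det)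
      (μ.restrict (ball (0 : V) R)) := by
    refine ContinuousOn.aestronglyMeasurable ?_ measurableSet_ball
    exact ContinuousLinearMap.continuous_det.comp_continuousOn
      (continuousOn_const.add (hc.const_smul t))
  rw [integral_eq_lintegral_of_nonneg_ae ?_ hmeas, Measure.real, ← hcov]
  · congr 1
    refine setLIntegral_congr_fun measurableSet_ball fun x hx => ?_
    simp only [abs_of_pos (hpos x hx)]
  · filter_upwards [ae_restrict_mem measurableSet_ball] with x hx
    exact (hpos x hx).le

/-- The integral is polynomial in `t` and constant for small `t`, so it has the same value at `t =
1`, where the map need no longer be injective. -/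
theorem integral_det_one_add [MeasurableSpace V] [BorelSpace V]
    (μ : Measure V) [μ.IsAddHaarMeasure] {g : V → V} {L : ℝ≥0}
    (hg : LipschitzWith L g) {R : ℝ} (hR : ∀ x, R ≤ ‖x‖ → g x = 0)
    (hd : ∀ x ∈ ball (0 : V) R, HasFDerivAt g (fderiv ℝ g x) x)
    (hc : ContinuousOn (fderiv ℝ g) (ball (0 : V) R)) :
    ∫ x in ball (0 : V) R, (1 + fderiv ℝ g x).det ∂μ = μ.real (ball (0 : V) R) := by
  obtain ⟨s, hs0, hs⟩ : ∃ s : Finset ℝ, (∀ t ∈ s, 0 ≤ t ∧ t * L < 1) ∧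
      Module.finrank ℝ V < s.card := by
    have hinf : (Icc (0 : ℝ) (1 / (L + 1))).Infinite := Icc_infinite (by positivity)
    obtain ⟨s, hs, hcard⟩ := hinf.exists_subset_card_eq (Module.finrank ℝ V + 1)
    refine ⟨s, fun t ht => ⟨(hs ht).1, ?_⟩, by omega⟩
    have h1 := (hs ht).2
    have hL : (0 : ℝ) ≤ L := L.2
    calc t * L ≤ 1 / (L + 1) * L := mul_le_mul_of_nonneg_right h1 hL
      _ < 1 := by rw [one_div, inv_mul_lt_iff₀ (by positivity)]; linarith
  have hdet : ∀ x, (1 + fderiv ℝ g x).det =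
      ∑ t ∈ s, (Lagrange.basis s id t).eval 1 * (1 + t • fderiv ℝ g x).det := fun x =>
    det_one_add_eq_sum_lagrange (fderiv ℝ g x : V →ₗ[ℝ] V) s hs
  have hsum : ∑ t ∈ s, (Lagrange.basis s id t).eval 1 = (1 : ℝ) := by
    have := Lagrange.sum_basis (s := s) (v := (id : ℝ → ℝ)) Function.injective_id.injOn
      (Finset.card_pos.1 (by omega))
    rw [← Polynomial.eval_finsetSum, this, Polynomial.eval_one]
  simp only [hdet]
  rw [integral_finsetSum]
  · rw [Finset.sum_congr rfl fun t ht => by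
      rw [integral_const_mul, integral_det_one_add_smul μ hg hR hd hc (hs0 t ht).1 (hs0 t ht).2],
      ← Finset.sum_mul, hsum, one_mul]
  · intro t ht
    refine Integrable.const_mul ?_ _
    -- A non-integrable function has integral `0` by convention; the volume formula would then make
    -- the ball a null set, on which everything is integrable.
    by_contra hni
    have h1 := integral_det_one_add_smul μ hg hR hd hc (hs0 t ht).1 (hs0 t ht).2
    rw [integral_undef hni] at h1
    have h2 : μ (ball (0 : V) R) = 0 := by
      rw [Measure.real, eq_comm, ENNReal.toReal_eq_zero_iff] at h1
      exact h1.resolve_right measure_ball_lt_top.ne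
    rw [Measure.restrict_eq_zero.2 h2] at hni
    exact hni integrable_zero_measure

/-- Without a zero, `φ` could be smoothed and normalised to a `C¹` retraction `r` of the ball of
radius `2` onto its boundary sphere. The integral of `det Dr` would be the volume of the ball, yet
`Dr` is singular everywhere because `‖r‖` is constant. -/
theorem exists_eq_zero_of_eq_id_of_one_le_norm [Nontrivial V] {φ : V → V} (hφ : Continuous φ)
    (h1 : ∀ x, 1 ≤ ‖x‖ → φ x = x) : ∃ x, φ x = 0 := by
  by_contra! hne
  borelize V
  -- The tolerance `‖φ x‖` keeps `F` free of zeros, and the margin between the radii `1` and `3/2`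
  -- lets `F` coincide with the identity near the sphere of radius `2`.
  obtain ⟨F, hF, hFd, hFS, -⟩ := hφ.exists_contDiff_approx_and_eqOn ⊤ hφ.norm
    (fun x => norm_pos_iff.2 (hne x)) (S := {x | 3 / 2 ≤ ‖x‖}) (U := {x | 1 < ‖x‖})
    (isClosed_le continuous_const continuous_norm)
    ((isOpen_lt continuous_const continuous_norm).mem_nhdsSet.2 fun x hx => by
      simp only [mem_ofPred_eq] at hx ⊢; linarith)
    (contDiff_id.contDiffOn.congr fun x hx => h1 x (le_of_lt hx))
  have hF0 : ∀ x, F x ≠ 0 := fun x h0 => by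
    have := hFd x
    rw [h0, dist_zero_left] at this
    exact lt_irrefl _ this
  let r : V → V := fun x => (2 / ‖F x‖) • F x
  have hr : ContDiff ℝ 1 r :=
    ((contDiff_const.div (hF.norm ℝ hF0) fun x => norm_ne_zero_iff.2 (hF0 x)).smul hF).of_le
      (by exact_mod_cast le_top)
  have hrn : ∀ x, ‖r x‖ = 2 := fun x => by
    simp only [r, norm_smul, norm_div, norm_norm, Real.norm_ofNat]
    exact div_mul_cancel₀ _ (norm_ne_zero_iff.2 (hF0 x))
  have hr2 : ∀ x, ‖x‖ = 2 → r x = x := fun x hx => by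
    have hx1 : F x = x := by
      rw [hFS (by simp only [mem_ofPred_eq, hx]; norm_num), h1 x (by rw [hx]; norm_num)]
    simp only [r, hx1, hx]
    norm_num
  let g₀ : V → V := fun x => r x - x
  have hg₀ : ContDiff ℝ 1 g₀ := hr.sub contDiff_id
  obtain ⟨L, hL⟩ : ∃ L : ℝ≥0, LipschitzOnWith L g₀ (closedBall 0 2) := by
    obtain ⟨C, hC⟩ := (isCompact_closedBall (0 : V) 2).exists_bound_of_continuousOn
      (hg₀.continuous_fderiv one_ne_zero).continuousOn
    refine ⟨C.toNNReal, (convex_closedBall (0 : V) 2).lipschitzOnWith_of_nnnorm_fderiv_le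
      (𝕜 := ℝ) (fun x _ => hg₀.differentiable one_ne_zero x) fun x hx => ?_⟩
    rw [← NNReal.coe_le_coe]
    exact (hC x hx).trans (Real.le_coe_toNNReal C)
  let g : V → V := (closedBall (0 : V) 2).indicator g₀
  have hgs : ∀ x, ‖x‖ = 2 → g₀ x = 0 := fun x hx => by simp only [g₀, hr2 x hx, sub_self]
  have hout : ∀ x, 2 ≤ ‖x‖ → g x = 0 := fun x hx => by
    by_cases hx2 : x ∈ closedBall (0 : V) 2
    · simp only [g, indicator_of_mem hx2]
      exact hgs x (le_antisymm (mem_closedBall_zero_iff.1 hx2) hx)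
    · exact indicator_of_notMem hx2 _
  -- Comparison with the radial projection to the sphere, where `g₀` vanishes: this decay makes the
  -- extension of `g₀` by zero Lipschitz with the same constant.
  have hbd : ∀ x, ‖x‖ ≤ 2 → ‖g₀ x‖ ≤ L * (2 - ‖x‖) := fun x hx => by
    obtain ⟨y, hy, hxy⟩ : ∃ y : V, ‖y‖ = 2 ∧ ‖x - y‖ = 2 - ‖x‖ := by
      rcases eq_or_ne x 0 with rfl | hx0
      · obtain ⟨y, hy⟩ := exists_norm_eq V (c := 2) (by norm_num)
        exact ⟨y, hy, by simp [hy]⟩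
      · have hx0' : ‖x‖ ≠ 0 := norm_ne_zero_iff.2 hx0
        refine ⟨(2 / ‖x‖) • x, ?_, ?_⟩
        · rw [norm_smul, norm_div, norm_norm, Real.norm_ofNat, div_mul_cancel₀ _ hx0']
        · have : x - (2 / ‖x‖) • x = (1 - 2 / ‖x‖) • x := by module
          rw [this, norm_smul, Real.norm_eq_abs, abs_of_nonpos, neg_sub, sub_mul,
            div_mul_cancel₀ _ hx0', one_mul]
          rw [sub_nonpos, le_div_iff₀ (norm_pos_iff.2 hx0)]
          linarith
    have h := hL.dist_le_mul x (mem_closedBall_zero_iff.2 hx) y (mem_closedBall_zero_iff.2 hy.le)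
    rwa [hgs y hy, dist_zero_right, dist_eq_norm, hxy] at h
  have hmix : ∀ x y, ‖x‖ ≤ 2 → 2 < ‖y‖ → dist (g x) (g y) ≤ L * dist x y := fun x y hx hy => by
    rw [hout y hy.le, dist_zero_right]
    simp only [g, indicator_of_mem (mem_closedBall_zero_iff.2 hx)]
    refine (hbd x hx).trans (mul_le_mul_of_nonneg_left ?_ L.2)
    have := norm_sub_norm_le y x
    rw [dist_comm, dist_eq_norm]
    linarith
  have hg : LipschitzWith L g := LipschitzWith.of_dist_le_mul fun x y => by
    rcases le_or_gt ‖x‖ 2 with hx | hx <;> rcases le_or_gt ‖y‖ 2 with hy | hy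
    · simp only [g, indicator_of_mem (mem_closedBall_zero_iff.2 hx),
        indicator_of_mem (mem_closedBall_zero_iff.2 hy)]
      exact hL.dist_le_mul x (mem_closedBall_zero_iff.2 hx) y (mem_closedBall_zero_iff.2 hy)
    · exact hmix x y hx hy
    · rw [dist_comm, dist_comm x]
      exact hmix y x hy hx
    · rw [hout x hx.le, hout y hy.le, dist_self]
      positivity
  have heq : ∀ x ∈ ball (0 : V) 2, g =ᶠ[𝓝 x] g₀ := fun x hx => by
    filter_upwards [isOpen_ball.mem_nhds hx] with y hy
    exact indicator_of_mem (ball_subset_closedBall hy) _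
  have hfd : ∀ x ∈ ball (0 : V) 2, fderiv ℝ g x = fderiv ℝ g₀ x := fun x hx =>
    (heq x hx).fderiv_eq
  have hint := integral_det_one_add (volume : Measure V) hg hout
    (fun x hx => ((heq x hx).differentiableAt_iff.2
      (hg₀.differentiable one_ne_zero x)).hasFDerivAt)
    ((hg₀.continuous_fderiv one_ne_zero).continuousOn.congr hfd)
  have hdet : ∀ x ∈ ball (0 : V) 2, (1 + fderiv ℝ g x).det = 0 := fun x hx => by
    have hrd : HasFDerivAt r (fderiv ℝ r x) x := (hr.differentiable one_ne_zero x).hasFDerivAt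
    have hgr : 1 + fderiv ℝ g x = fderiv ℝ r x := by
      have h2 : HasFDerivAt g₀ _ x := hrd.sub (hasFDerivAt_id x)
      rw [hfd x hx, h2.fderiv]
      ext v
      simp
    rw [hgr]
    -- If the derivative were invertible, some `v` would satisfy `Dr v = r x`; differentiating `‖r‖²
    -- = 4` along `v` would give `⟨r x, r x⟩ = 0`.
    by_contra hdne
    have hsurj : Function.Surjective (fderiv ℝ r x) :=
      (LinearMap.equivOfDetNeZero (fderiv ℝ r x : V →ₗ[ℝ] V) hdne).surjective
    obtain ⟨v, hv⟩ := hsurj (r x)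
    have hsq := hrd.norm_sq
    have hconst : (fun y => ‖r y‖ ^ 2) = fun _ => (4 : ℝ) := by
      funext y
      rw [hrn]; norm_num
    rw [hconst] at hsq
    have h0 := congrArg (fun T : V →L[ℝ] ℝ => T v) (hsq.unique (hasFDerivAt_const (4 : ℝ) x))
    simp [hv, hrn] at h0
  rw [setIntegral_congr_fun measurableSet_ball hdet, integral_zero] at hint
  have hpos : 0 < (volume : Measure V).real (ball (0 : V) 2) :=
    ENNReal.toReal_pos (measure_ball_pos _ _ (by norm_num)).ne' measure_ball_lt_top.ne
  exact hpos.ne hint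

/-- The identity of the unit sphere is not homotopic in `V \ {0}` to a map that omits a ray. -/
theorem exists_mem_ray_of_homotopy {f : V × ℝ → V} (hf : Continuous f)
    (hf0 : ∀ x, ‖x‖ = 1 → f (x, 0) = x)
    (hfne : ∀ x, ‖x‖ = 1 → ∀ u ∈ Icc (0 : ℝ) 1, f (x, u) ≠ 0) {e : V} (he : e ≠ 0) :
    ∃ x, ‖x‖ = 1 ∧ ∃ s : ℝ, 0 ≤ s ∧ f (x, 1) = s • e := by
  by_contra! hray
  have : Nontrivial V := ⟨e, 0, he⟩
  -- The map `φ` is the identity for `‖x‖ ≥ 1`, runs through the homotopy for `1/2 ≤ ‖x‖ ≤ 1`, and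
  -- inside radius `1/2` is the cone over `f (·, 1)` shifted by a nonnegative multiple of `-e`. A
  -- zero can only occur in the last region, and there it puts a value of `f (·, 1)` on the ray.
  let c : ℝ → ℝ := fun s => max 0 (min 1 (2 - 2 * s))
  have hc : Continuous c := by fun_prop
  let q : V → V := fun x => ‖x‖ • f (‖x‖⁻¹ • x, c ‖x‖)
  let φ : V → V := fun x => q x - max (1 - 2 * ‖x‖) 0 • e
  have hcI : ∀ s, c s ∈ Icc (0 : ℝ) 1 := fun s =>
    ⟨le_max_left _ _, max_le zero_le_one (min_le_left _ _)⟩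
  have hunit : ∀ x : V, x ≠ 0 → ‖‖x‖⁻¹ • x‖ = 1 := fun x hx => by
    rw [norm_smul, norm_inv, norm_norm, inv_mul_cancel₀ (norm_ne_zero_iff.2 hx)]
  have hq : Continuous q := by
    rw [continuous_iff_continuousAt]
    intro x
    rcases eq_or_ne x 0 with rfl | hx
    · obtain ⟨C, hC⟩ := ((isCompact_closedBall (0 : V) 1).prod
        (isCompact_Icc (a := (0 : ℝ)) (b := 1))).exists_bound_of_continuousOn hf.continuousOn
      have hq0 : q 0 = 0 := by simp [q]
      rw [ContinuousAt, hq0]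
      refine squeeze_zero_norm (a := fun x => ‖x‖ * C) (fun x => ?_) ?_
      · simp only [q, norm_smul, norm_norm]
        refine mul_le_mul_of_nonneg_left (hC _ ⟨?_, hcI _⟩) (norm_nonneg _)
        rw [mem_closedBall_zero_iff]
        rcases eq_or_ne x 0 with rfl | hx
        · simp
        · exact (hunit x hx).le
      · have : Continuous fun x : V => ‖x‖ * C := by fun_prop
        simpa using this.tendsto 0
    · have hinv : ContinuousAt (fun y : V => ‖y‖⁻¹) x :=
        continuous_norm.continuousAt.inv₀ (norm_ne_zero_iff.2 hx)
      exact continuous_norm.continuousAt.smul (hf.continuousAt.comp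
        ((hinv.smul continuousAt_id).prodMk (hc.comp continuous_norm).continuousAt))
  have hφ : Continuous φ := hq.sub (by fun_prop)
  obtain ⟨x, hx⟩ := exists_eq_zero_of_eq_id_of_one_le_norm hφ fun x hx => by
    have hx0 : x ≠ 0 := norm_pos_iff.1 (by linarith)
    have h1 : c ‖x‖ = 0 := max_eq_left ((min_le_right _ _).trans (by linarith))
    have h2 : max (1 - 2 * ‖x‖) 0 = 0 := max_eq_right (by linarith)
    simp only [φ, q, h1, h2, hf0 _ (hunit x hx0), zero_smul, sub_zero]
    rw [smul_inv_smul₀ (norm_ne_zero_iff.2 hx0)]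
  have hx0 : x ≠ 0 := by
    rintro rfl
    simp [φ, q] at hx
    exact he hx
  have hn : 0 < ‖x‖ := norm_pos_iff.2 hx0
  simp only [φ, q, sub_eq_zero] at hx
  rcases le_or_gt (1 / 2) ‖x‖ with h | h
  · have h2 : max (1 - 2 * ‖x‖) 0 = 0 := max_eq_right (by linarith)
    rw [h2, zero_smul, smul_eq_zero] at hx
    exact hx.elim hn.ne' (hfne _ (hunit x hx0) _ (hcI _))
  · have h1 : c ‖x‖ = 1 := by
      simp only [c]
      rw [min_eq_left (by linarith), max_eq_right zero_le_one]
    rw [h1] at hx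
    refine hray _ (hunit x hx0) (‖x‖⁻¹ * max (1 - 2 * ‖x‖) 0) (by positivity) ?_
    rw [mul_smul, ← hx, inv_smul_smul₀ hn.ne']

end Brouwer

end SymEH

/-! ### Fourier description of `𝔼`, completeness and compact embedding into `L²` -/

namespace SymEH

theorem inner_mode {n : ℕ} (j k : ℤ) (v w : Phase n) :
    ⟪mode n j v, mode n k w⟫_ℝ = if k = j then ⟪v, w⟫_ℝ else 0 := by
  rw [← inner_coeff, coeff_mode]
  split_ifs <;> simp

theorem norm_mode {n : ℕ} (j : ℤ) (v : Phase n) : ‖mode n j v‖ = ‖v‖ := by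
  have h := inner_mode j j v v
  rw [if_pos rfl, real_inner_self_eq_norm_sq, real_inner_self_eq_norm_sq] at h
  exact (sq_eq_sq₀ (norm_nonneg _) (norm_nonneg _)).1 h

theorem norm_J0 {n : ℕ} (v : Phase n) : ‖J0 n v‖ = ‖v‖ := by
  have h := inner_J0_left v (J0 n v)
  rw [J0_J0, inner_neg_right, neg_neg, real_inner_self_eq_norm_sq, real_inner_self_eq_norm_sq] at h
  exact (sq_eq_sq₀ (norm_nonneg _) (norm_nonneg _)).1 h

theorem norm_rot_le {n : ℕ} (j : ℤ) (t : UnitAddCircle) (v : Phase n) :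
    ‖rot n j t v‖ ≤ 2 * ‖v‖ := by
  have hn : ‖(fourier j t : ℂ)‖ ≤ 1 := by
    rw [fourier_apply]; exact (Circle.norm_coe _).le
  refine (norm_add_le _ _).trans ?_
  rw [norm_smul, norm_smul, norm_J0, two_mul]
  exact add_le_add
    (mul_le_of_le_one_left (norm_nonneg _) ((Complex.abs_re_le_norm _).trans hn))
    (mul_le_of_le_one_left (norm_nonneg _) ((Complex.abs_im_le_norm _).trans hn))

/-- `v ↦ e^{2πjtJ₀} v` as a linear isometry into `L²`. -/
noncomputable def modeIsometry (n : ℕ) (j : ℤ) : Phase n →ₗᵢ[ℝ] L2Loop n where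
  toLinearMap := mode n j
  norm_map' := norm_mode j

theorem orthogonalFamily_mode (n : ℕ) :
    OrthogonalFamily ℝ (fun _ : ℤ => Phase n) (modeIsometry n) := by
  intro j k hjk v w
  exact (inner_mode j k v w).trans (if_neg hjk.symm)

/-- The weight of the `j`-th mode in `⟨·, ·⟩_{1/2}`. -/
noncomputable def weight (j : ℤ) : ℝ := if j = 0 then 1 else 2 * Real.pi * |(j : ℝ)|

theorem weight_zero : weight 0 = 1 := if_pos rfl

theorem weight_of_ne {j : ℤ} (hj : j ≠ 0) : weight j = 2 * Real.pi * |(j : ℝ)| := if_neg hj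

theorem one_le_abs_cast {j : ℤ} (hj : j ≠ 0) : (1 : ℝ) ≤ |(j : ℝ)| := by
  rw [← Int.cast_abs]; exact_mod_cast Int.one_le_abs hj

theorem abs_le_weight (j : ℤ) : |(j : ℝ)| ≤ weight j := by
  by_cases hj : j = 0
  · subst hj; simp [weight]
  · rw [weight_of_ne hj]
    nlinarith [Real.pi_gt_three, one_le_abs_cast hj]

theorem one_le_weight (j : ℤ) : 1 ≤ weight j := by
  by_cases hj : j = 0
  · subst hj; simp [weight]
  · exact (one_le_abs_cast hj).trans (abs_le_weight j)

theorem weight_pos (j : ℤ) : 0 < weight j := zero_lt_one.trans_le (one_le_weight j)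

theorem weight_eq (j : ℤ) : weight j = (if j = 0 then 1 else 0) + |2 * Real.pi * (j : ℝ)| := by
  by_cases hj : j = 0
  · subst hj; simp [weight]
  · rw [weight_of_ne hj, if_neg hj, abs_mul, abs_of_pos Real.two_pi_pos, zero_add]

namespace E

variable {n : ℕ}

theorem ext_coef {x y : E n} (h : ∀ j, x.coef j = y.coef j) : x = y := by
  refine toL2_injective (x.coef_spec.2.2.unique ?_)
  simpa only [h] using y.coef_spec.2.2

theorem coef_zero (j : ℤ) : (0 : E n).coef j = 0 := by
  simpa using coef_smul (0 : ℝ) (0 : E n) j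

theorem coef_neg (x : E n) (j : ℤ) : (-x).coef j = -x.coef j := by
  simpa using coef_smul (-1 : ℝ) x j

theorem coef_sub (x y : E n) (j : ℤ) : (x - y).coef j = x.coef j - y.coef j := by
  rw [sub_eq_add_neg, coef_add, coef_neg, ← sub_eq_add_neg]

theorem hasSum_inner (x y : E n) :
    HasSum (fun j => weight j * ⟪x.coef j, y.coef j⟫_ℝ) ⟪x, y⟫_ℝ := by
  have h1 := (summable_inner x y).hasSum
  have h2 := hasSum_ite_eq (0 : ℤ) (⟪x.coef 0, y.coef 0⟫_ℝ)
  refine (h2.add h1).congr_fun fun j => ?_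
  rw [weight_eq, add_mul]
  by_cases hj : j = 0
  · subst hj; simp
  · simp [hj]

theorem hasSum_norm_sq (x : E n) : HasSum (fun j => weight j * ‖x.coef j‖ ^ 2) (‖x‖ ^ 2) := by
  simpa only [real_inner_self_eq_norm_sq] using hasSum_inner x x

theorem hasSum_inner_toL2 (x y : E n) :
    HasSum (fun j => ⟪x.coef j, y.coef j⟫_ℝ) ⟪toL2 x, toL2 y⟫_ℝ := by
  have h := y.coef_spec.2.2.mapL (innerSL ℝ (toL2 x))
  refine h.congr_fun fun j => ?_
  rw [innerSL_apply_apply, real_inner_comm]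
  exact (inner_coeff (toL2 x) j (y.coef j)).trans (real_inner_comm _ _) |>.symm ▸ rfl

theorem hasSum_norm_sq_toL2 (x : E n) : HasSum (fun j => ‖x.coef j‖ ^ 2) (‖toL2 x‖ ^ 2) := by
  simpa only [real_inner_self_eq_norm_sq] using hasSum_inner_toL2 x x

theorem norm_toL2_le (x : E n) : ‖toL2 x‖ ≤ ‖x‖ := by
  refine (sq_le_sq₀ (norm_nonneg _) (norm_nonneg _)).1 ?_
  refine hasSum_le (fun j => ?_) (hasSum_norm_sq_toL2 x) (hasSum_norm_sq x)
  exact le_mul_of_one_le_left (sq_nonneg _) (one_le_weight j)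

/-- The inclusion `𝔼 ⊆ L²(S¹; ℝ²ⁿ)` as a continuous linear map. -/
noncomputable def toL2L (n : ℕ) : E n →L[ℝ] L2Loop n :=
  toL2.mkContinuous 1 fun x => by simpa using norm_toL2_le x

theorem coef_part (A : Set ℤ) (x : E n) (j : ℤ) : (x.part A).coef j = A.indicator x.coef j := by
  have h : HasSum (fun j : ℤ => mode n j (A.indicator x.coef j)) (toL2 (x.part A)) := by
    refine Summable.hasSum ((x.coef_spec.2.2.summable.indicator A).congr fun j => ?_)
    by_cases hj : j ∈ A <;> simp [hj]
  exact congrFun (coeff_eq_of_hasSum h) j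

theorem coef_part_of_mem {A : Set ℤ} (x : E n) {j : ℤ} (hj : j ∈ A) :
    (x.part A).coef j = x.coef j := by rw [coef_part, indicator_of_mem hj]

theorem coef_part_of_notMem {A : Set ℤ} (x : E n) {j : ℤ} (hj : j ∉ A) :
    (x.part A).coef j = 0 := by rw [coef_part, indicator_of_notMem hj]

theorem hasSum_norm_sq_part (A : Set ℤ) (x : E n) :
    HasSum (A.indicator fun j => weight j * ‖x.coef j‖ ^ 2) (‖x.part A‖ ^ 2) := by
  refine (hasSum_norm_sq (x.part A)).congr_fun fun j => ?_
  by_cases hj : j ∈ A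
  · rw [indicator_of_mem hj, coef_part_of_mem x hj]
  · rw [indicator_of_notMem hj, coef_part_of_notMem x hj]; simp

theorem norm_part_le (A : Set ℤ) (x : E n) : ‖x.part A‖ ≤ ‖x‖ := by
  refine (sq_le_sq₀ (norm_nonneg _) (norm_nonneg _)).1 ?_
  refine hasSum_le (fun j => ?_) (hasSum_norm_sq_part A x) (hasSum_norm_sq x)
  exact indicator_le_self' (fun _ _ => mul_nonneg (weight_pos _).le (sq_nonneg _)) j

/-- The projection `x ↦ x.part A` as a continuous linear map. -/
noncomputable def partL (n : ℕ) (A : Set ℤ) : E n →L[ℝ] E n :=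
  LinearMap.mkContinuous
    { toFun := part A
      map_add' := fun x y => ext_coef fun j => by
        by_cases hj : j ∈ A
        · simp only [coef_add, coef_part_of_mem _ hj]
        · simp only [coef_add, coef_part_of_notMem _ hj, add_zero]
      map_smul' := fun r x => ext_coef fun j => by
        by_cases hj : j ∈ A
        · simp only [coef_smul, coef_part_of_mem _ hj, RingHom.id_apply]
        · simp only [coef_smul, coef_part_of_notMem _ hj, RingHom.id_apply, smul_zero] }
    1 fun x => by simpa using norm_part_le A x

theorem partL_apply (A : Set ℤ) (x : E n) : partL n A x = x.part A := rfl

theorem inner_part_left (A : Set ℤ) (x y : E n) : ⟪x.part A, y⟫_ℝ = ⟪x, y.part A⟫_ℝ := by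
  refine (hasSum_inner (x.part A) y).unique ((hasSum_inner x (y.part A)).congr_fun fun j => ?_)
  by_cases hj : j ∈ A
  · rw [coef_part_of_mem _ hj, coef_part_of_mem _ hj]
  · rw [coef_part_of_notMem _ hj, coef_part_of_notMem _ hj]; simp

theorem part_part (A B : Set ℤ) (x : E n) : (x.part A).part B = x.part (B ∩ A) := by
  refine ext_coef fun j => ?_
  rw [coef_part, coef_part, ← indicator_indicator]
  congr 1
  funext k
  exact coef_part A x k

theorem part_empty (x : E n) : x.part ∅ = 0 :=
  ext_coef fun j => by rw [coef_part_of_notMem _ (notMem_empty j), coef_zero]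

theorem part_add_part_compl (A : Set ℤ) (x : E n) : x.part A + x.part Aᶜ = x := by
  refine ext_coef fun j => ?_
  rw [coef_add, coef_part, coef_part]
  exact indicator_self_add_compl_apply A x.coef j

theorem norm_sq_part_add_compl (A : Set ℤ) (x : E n) :
    ‖x‖ ^ 2 = ‖x.part A‖ ^ 2 + ‖x.part Aᶜ‖ ^ 2 := by
  refine (hasSum_norm_sq x).unique
    (((hasSum_norm_sq_part A x).add (hasSum_norm_sq_part Aᶜ x)).congr_fun fun j => ?_)
  exact indicator_self_add_compl_apply A (fun j => weight j * ‖x.coef j‖ ^ 2) j |>.symm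

theorem plus_add_zero_add_minus (x : E n) : x.plus + x.zero + x.minus = x := by
  refine ext_coef fun j => ?_
  simp only [coef_add, plus, zero, minus, coef_part]
  rcases lt_trichotomy j 0 with h | h | h
  · simp [h, h.ne, not_lt.2 h.le]
  · simp [h]
  · simp [h, h.ne', not_lt.2 h.le]

theorem norm_sq_eq (x : E n) : ‖x‖ ^ 2 = ‖x.plus‖ ^ 2 + ‖x.zero‖ ^ 2 + ‖x.minus‖ ^ 2 := by
  refine (hasSum_norm_sq x).unique ((((hasSum_norm_sq_part {j | 0 < j} x).add
    (hasSum_norm_sq_part {0} x)).add (hasSum_norm_sq_part {j | j < 0} x)).congr_fun fun j => ?_)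
  rcases lt_trichotomy j 0 with h | h | h
  · simp [indicator, h, h.ne, not_lt.2 h.le]
  · simp [indicator, h]
  · simp [indicator, h, h.ne', not_lt.2 h.le]

theorem norm_zero_sq (x : E n) : ‖x.zero‖ ^ 2 = ‖x.coef 0‖ ^ 2 := by
  refine (hasSum_norm_sq_part {0} x).unique ((hasSum_ite_eq (0 : ℤ) _).congr_fun fun j => ?_)
  by_cases hj : j = 0
  · subst hj; simp [weight_zero]
  · simp [hj]

theorem norm_zero_le_toL2 (x : E n) : ‖x.zero‖ ^ 2 ≤ ‖toL2 x‖ ^ 2 := by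
  rw [norm_zero_sq]
  exact le_hasSum (hasSum_norm_sq_toL2 x) 0 fun _ _ => sq_nonneg _

theorem plus_eq_self_iff {x : E n} : x.plus = x ↔ x ∈ Eplus n := by
  constructor
  · intro h j hj
    rw [← h]
    exact coef_part_of_notMem x hj
  · intro h
    refine ext_coef fun j => ?_
    by_cases hj : j ∈ {j : ℤ | 0 < j}
    · exact coef_part_of_mem x hj
    · exact (coef_part_of_notMem x hj).trans (h j hj).symm

theorem mem_Eminus_sup_Ezero_iff {x : E n} : x ∈ Eminus n ⊔ Ezero n ↔ x.plus = 0 := by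
  constructor
  · intro h
    obtain ⟨y, hy, z, hz, rfl⟩ := Submodule.mem_sup.1 h
    refine ext_coef fun j => ?_
    rw [coef_zero, plus, coef_part]
    by_cases hj : 0 < j
    · have h1 : y.coef j = 0 := hy j (by simp [hj.le])
      have h2 : z.coef j = 0 := hz j (by simp [hj.ne'])
      simp [hj, coef_add, h1, h2]
    · simp [hj]
  · intro h
    have h1 := plus_add_zero_add_minus x
    rw [h, zero_add, add_comm] at h1
    rw [← h1]
    exact Submodule.add_mem_sup (fun j hj => coef_part_of_notMem x hj)
      fun j hj => coef_part_of_notMem x hj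

theorem exists_coef_eq {c : ℤ → Phase n} (hc : ∀ j, c j ∈ L0 n)
    (hs : Summable fun j : ℤ => weight j * ‖c j‖ ^ 2) : ∃ x : E n, x.coef = c := by
  have h1 : Summable fun j => ‖c j‖ ^ 2 := Summable.of_nonneg_of_le (fun j => sq_nonneg _)
    (fun j => le_mul_of_one_le_left (sq_nonneg _) (one_le_weight j)) hs
  have h2 : Summable fun j : ℤ => |(j : ℝ)| * ‖c j‖ ^ 2 :=
    Summable.of_nonneg_of_le (fun j => by positivity)
      (fun j => mul_le_mul_of_nonneg_right (abs_le_weight j) (sq_nonneg _)) hs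
  have h3 : Summable fun j => mode n j (c j) :=
    ((orthogonalFamily_mode n).summable_iff_norm_sq_summable c).2 h1
  exact ⟨⟨∑' j, mode n j (c j), c, hc, h2, h3.hasSum⟩, coeff_eq_of_hasSum h3.hasSum⟩

/-- The isometric identification of `𝔼` with the sequences in `ℓ²(ℤ; L₀)`. -/
noncomputable def toSeq (n : ℕ) : E n →ₗᵢ[ℝ] lp (fun _ : ℤ => L0 n) 2 where
  toFun x := ⟨fun j => Real.sqrt (weight j) • ⟨x.coef j, x.coef_spec.1 j⟩, by
    refine memℓp_gen ((hasSum_norm_sq x).summable.congr fun j => ?_)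
    rw [norm_smul, Real.norm_of_nonneg (Real.sqrt_nonneg _), ENNReal.toReal_ofNat,
      Real.rpow_ofNat, mul_pow, Real.sq_sqrt (weight_pos j).le]
    rfl⟩
  map_add' x y := by
    refine Subtype.ext (funext fun j => Subtype.ext ?_)
    change Real.sqrt (weight j) • (x + y).coef j =
      Real.sqrt (weight j) • x.coef j + Real.sqrt (weight j) • y.coef j
    rw [coef_add, smul_add]
  map_smul' r x := by
    refine Subtype.ext (funext fun j => Subtype.ext ?_)
    change Real.sqrt (weight j) • (r • x).coef j = r • Real.sqrt (weight j) • x.coef j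
    rw [coef_smul, smul_comm]
  norm_map' x := by
    refine (sq_eq_sq₀ (norm_nonneg _) (norm_nonneg _)).1 ?_
    rw [← real_inner_self_eq_norm_sq]
    refine (lp.hasSum_inner _ _).unique ((hasSum_norm_sq x).congr_fun fun j => ?_)
    rw [real_inner_self_eq_norm_sq]
    change ‖Real.sqrt (weight j) • (⟨x.coef j, x.coef_spec.1 j⟩ : L0 n)‖ ^ 2 = _
    rw [norm_smul, Real.norm_of_nonneg (Real.sqrt_nonneg _), mul_pow,
      Real.sq_sqrt (weight_pos j).le]
    rfl

theorem toSeq_surjective : Function.Surjective (toSeq n) := by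
  intro f
  have hs : ∀ j, weight j * ‖(Real.sqrt (weight j))⁻¹ • (f j : Phase n)‖ ^ 2 = ⟪f j, f j⟫_ℝ := by
    intro j
    rw [real_inner_self_eq_norm_sq, norm_smul, norm_inv, Real.norm_of_nonneg (Real.sqrt_nonneg _),
      mul_pow, inv_pow, Real.sq_sqrt (weight_pos j).le, mul_inv_cancel_left₀ (weight_pos j).ne']
    rfl
  obtain ⟨x, hx⟩ := exists_coef_eq (c := fun j => (Real.sqrt (weight j))⁻¹ • (f j : Phase n))
    (fun j => (L0 n).smul_mem _ (f j).2) ((lp.summable_inner f f).congr fun j => (hs j).symm)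
  refine ⟨x, ?_⟩
  refine Subtype.ext (funext fun j => Subtype.ext ?_)
  change Real.sqrt (weight j) • x.coef j = f j
  rw [hx, smul_inv_smul₀ (Real.sqrt_pos.2 (weight_pos j)).ne']

/-- Transported from `ℓ²(ℤ; L₀)`. The adjoint of the inclusion, the bijectivity of the Euler step
and the closed range argument for Palais–Smale rest on it. -/
instance : CompleteSpace (E n) := by
  have e : E n ≃ₗᵢ[ℝ] lp (fun _ : ℤ => L0 n) 2 :=
    LinearIsometryEquiv.ofSurjective (toSeq n) toSeq_surjective
  exact (completeSpace_congr (e := e.toEquiv) e.isometry.isUniformEmbedding).2 inferInstance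

/-- The element `t ↦ e^{2πjtJ₀} v` of `𝔼`, for `v ∈ L₀`. -/
noncomputable def single (j : ℤ) (v : L0 n) : E n :=
  ⟨mode n j v, fun k => if j = k then (v : Phase n) else 0, by
    intro k
    dsimp only
    split_ifs
    · exact v.2
    · exact (L0 n).zero_mem, by
    refine summable_of_ne_finset_zero (s := {j}) fun k hk => ?_
    dsimp only
    rw [if_neg (by simpa [eq_comm] using hk)]; simp, by
    have h := hasSum_single (f := fun k => mode n k (if j = k then (v : Phase n) else 0)) j
      fun k hk => by rw [if_neg hk.symm, map_zero]
    rwa [if_pos rfl] at h⟩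

theorem toL2_single (j : ℤ) (v : L0 n) : toL2 (single j v) = mode n j v := rfl

theorem coef_single (j : ℤ) (v : L0 n) (k : ℤ) :
    (single j v).coef k = if j = k then (v : Phase n) else 0 := by
  rw [coef, toL2_single, coeff_mode]

theorem norm_single_sq (j : ℤ) (v : L0 n) : ‖single j v‖ ^ 2 = weight j * ‖(v : Phase n)‖ ^ 2 := by
  refine (hasSum_norm_sq (single j v)).unique ((hasSum_ite_eq j _).congr_fun fun k => ?_)
  rw [coef_single]
  by_cases hk : k = j
  · subst hk; simp
  · simp [hk, Ne.symm hk]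

/-- For `|j| > N` the weight is at least `N + 1`. This uniform smallness of tails in `L²` is the
source of all compactness below. -/
theorem norm_toL2_part_compl_sq_le (N : ℕ) (x : E n) :
    ‖toL2 (x.part (Icc (-N : ℤ) N)ᶜ)‖ ^ 2 ≤ ‖x‖ ^ 2 / (N + 1) := by
  refine hasSum_le (fun j => ?_) (hasSum_norm_sq_toL2 _) ((hasSum_norm_sq x).div_const _)
  by_cases hj : j ∈ (Icc (-N : ℤ) N)
  · rw [coef_part_of_notMem _ (by simpa using hj), norm_zero, zero_pow two_ne_zero]
    have := weight_pos j
    positivity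
  · rw [coef_part_of_mem _ hj, le_div_iff₀ (by positivity), mul_comm]
    refine mul_le_mul_of_nonneg_right (le_trans ?_ (abs_le_weight j)) (sq_nonneg _)
    have h : (N : ℤ) + 1 ≤ |j| := by
      by_contra hlt
      exact hj (by rw [mem_Icc, ← abs_le]; omega)
    rw [← Int.cast_abs]
    exact_mod_cast h

/-- The norms of the truncations converge to `‖x‖`, and by orthogonality the error is controlled by
the difference of the squared norms. -/
theorem tendsto_part (x : E n) :
    Filter.Tendsto (fun N : ℕ => x.part (Icc (-N : ℤ) N)) Filter.atTop (nhds x) := by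
  rw [tendsto_iff_norm_sub_tendsto_zero]
  have h1 : Filter.Tendsto (fun N : ℕ => ‖x.part (Icc (-N : ℤ) N)‖ ^ 2) Filter.atTop
      (nhds (‖x‖ ^ 2)) := by
    have h := (hasSum_norm_sq x).comp (Finset.tendsto_Icc_neg (R := ℤ))
    refine h.congr fun N => ?_
    have h2 := hasSum_norm_sq_part (Icc (-N : ℤ) N) x
    rw [Function.comp_apply]
    refine HasSum.unique ?_ h2
    rw [Finset.sum_congr rfl fun j hj =>
      (indicator_of_mem (s := Icc (-N : ℤ) N) (by simpa using hj)
        (fun j => weight j * ‖x.coef j‖ ^ 2)).symm]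
    exact hasSum_sum_of_ne_finset_zero fun j hj => indicator_of_notMem (by simpa using hj) _
  have h2 : ∀ N : ℕ, ‖x.part (Icc (-N : ℤ) N) - x‖ =
      Real.sqrt (‖x‖ ^ 2 - ‖x.part (Icc (-N : ℤ) N)‖ ^ 2) := fun N => by
    have h3 := norm_sq_part_add_compl (Icc (-N : ℤ) N) x
    have h4 := part_add_part_compl (Icc (-N : ℤ) N) x
    rw [h3, add_sub_cancel_left, Real.sqrt_sq (norm_nonneg _), norm_sub_rev]
    nth_rewrite 1 [← h4]
    rw [add_sub_cancel_left]
  simp only [h2]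
  have h5 := (Real.continuous_sqrt.tendsto _).comp (h1.const_sub (‖x‖ ^ 2))
  rw [sub_self, Real.sqrt_zero] at h5
  exact h5

/-- A substitute for the missing embedding of `𝔼` into bounded functions: finitely many modes are
bounded pointwise, since each coefficient is at most `‖x‖`. -/
theorem ae_norm_toL2_part_le (N : ℕ) :
    ∃ C : ℝ, 0 ≤ C ∧ ∀ x : E n,
      ∀ᵐ t, ‖toL2 (x.part (Icc (-N : ℤ) N)) t‖ ≤ C * ‖x‖ := by
  refine ⟨∑ _j ∈ Finset.Icc (-N : ℤ) N, 2, by positivity, fun x => ?_⟩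
  have h1 : toL2 (x.part (Icc (-N : ℤ) N)) = ∑ j ∈ Finset.Icc (-N : ℤ) N, mode n j (x.coef j) := by
    have h := (x.part (Icc (-N : ℤ) N)).coef_spec.2.2
    refine h.unique ?_
    rw [Finset.sum_congr rfl fun j hj => by
      rw [← coef_part_of_mem (A := Icc (-N : ℤ) N) x (by simpa using hj)]]
    refine hasSum_sum_of_ne_finset_zero fun j hj => ?_
    rw [coef_part_of_notMem x (by simpa using hj), map_zero]
  let f : C(UnitAddCircle, Phase n) :=
    ∑ j ∈ Finset.Icc (-N : ℤ) N, ⟨fun t => rot n j t (x.coef j), continuous_rot n j _⟩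
  have h2 : toL2 (x.part (Icc (-N : ℤ) N)) = ContinuousMap.toLp 2 volume ℝ f := by
    rw [h1, map_sum]
    rfl
  have hc : ∀ j, ‖x.coef j‖ ≤ ‖x‖ := fun j => by
    refine (sq_le_sq₀ (norm_nonneg _) (norm_nonneg _)).1 ?_
    exact (le_mul_of_one_le_left (sq_nonneg _) (one_le_weight j)).trans
      (le_hasSum (hasSum_norm_sq x) j fun k _ => mul_nonneg (weight_pos k).le (sq_nonneg _))
  rw [h2]
  filter_upwards [ContinuousMap.coeFn_toLp (𝕜 := ℝ) (p := 2) volume f] with t ht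
  rw [ht]
  simp only [f, ContinuousMap.coe_sum, Finset.sum_apply, ContinuousMap.coe_mk]
  rw [Finset.sum_mul]
  refine (norm_sum_le _ _).trans (Finset.sum_le_sum fun j _ => ?_)
  exact (norm_rot_le j t _).trans (mul_le_mul_of_nonneg_left (hc j) (by norm_num))

instance finiteDimensional_supportedOn (A : Set ℤ) [Finite A] :
    FiniteDimensional ℝ (supportedOn n A) := by
  let T : supportedOn n A →ₗ[ℝ] (A → Phase n) :=
    { toFun := fun x j => (x : E n).coef j
      map_add' := fun x y => funext fun j => coef_add _ _ _
      map_smul' := fun r x => funext fun j => coef_smul _ _ _ }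
  refine FiniteDimensional.of_injective T fun x y hxy => Subtype.ext (ext_coef fun j => ?_)
  by_cases hj : j ∈ A
  · exact congrFun hxy ⟨j, hj⟩
  · rw [x.2 j hj, y.2 j hj]

theorem part_mem_supportedOn (A : Set ℤ) (x : E n) : x.part A ∈ supportedOn n A :=
  fun _ hj => coef_part_of_notMem x hj

theorem isCompactOperator_partL (A : Set ℤ) [Finite A] : IsCompactOperator (partL n A) := by
  have h : IsCompactOperator ((partL n A).codRestrict (supportedOn n A)
      (part_mem_supportedOn A)) := by
    have : ProperSpace (supportedOn n A) := FiniteDimensional.proper_real _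
    exact isCompactOperator_of_locallyCompactSpace_dom _
  exact h.clm_comp (supportedOn n A).subtypeL

/-- The adjoint `L² → 𝔼` of the inclusion. -/
noncomputable def adjL (n : ℕ) : L2Loop n →L[ℝ] E n := ContinuousLinearMap.adjoint (toL2L n)

theorem inner_adjL (f : L2Loop n) (y : E n) : ⟪adjL n f, y⟫_ℝ = ⟪f, toL2 y⟫_ℝ :=
  ContinuousLinearMap.adjoint_inner_left _ _ _

theorem norm_adjL_le (f : L2Loop n) : ‖adjL n f‖ ≤ ‖f‖ := by
  have h := real_inner_le_norm f (toL2 (adjL n f))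
  rw [← inner_adjL, real_inner_self_eq_norm_sq] at h
  have h2 := h.trans (mul_le_mul_of_nonneg_left (norm_toL2_le (adjL n f)) (norm_nonneg f))
  nlinarith [norm_nonneg f, norm_nonneg (adjL n f)]

/-- It is a norm limit of its truncations to the modes `|j| ≤ N`, which have finite rank. By duality
with the `L²` tail estimate the error is at most `1 / √(N + 1)`. -/
theorem isCompactOperator_adjL : IsCompactOperator (adjL n) := by
  have hlim : Filter.Tendsto (fun N : ℕ => (partL n (Icc (-N : ℤ) N)).comp (adjL n))
      Filter.atTop (nhds (adjL n)) := by
    refine (tendsto_iff_norm_sub_tendsto_zero (E := L2Loop n →L[ℝ] E n)).2 ?_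
    have h0 : Filter.Tendsto (fun N : ℕ => Real.sqrt (1 / ((N : ℝ) + 1))) Filter.atTop
        (nhds 0) := by
      have := (Real.continuous_sqrt.tendsto _).comp
        (tendsto_one_div_add_atTop_nhds_zero_nat (𝕜 := ℝ))
      rw [Real.sqrt_zero] at this
      exact this
    refine squeeze_zero (fun _ => ContinuousLinearMap.opNorm_nonneg _) (fun N => ?_) h0
    refine ContinuousLinearMap.opNorm_le_bound _ (Real.sqrt_nonneg _) fun f => ?_
    have h1 : ((partL n (Icc (-N : ℤ) N)).comp (adjL n) - adjL n) f =
        -(adjL n f).part (Icc (-N : ℤ) N)ᶜ := by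
      have := part_add_part_compl (Icc (-N : ℤ) N) (adjL n f)
      rw [eq_neg_iff_add_eq_zero, sub_apply, ContinuousLinearMap.comp_apply,
        partL_apply]
      rw [sub_add_eq_add_sub, this, sub_self]
    set y := (adjL n f).part (Icc (-N : ℤ) N)ᶜ with hy
    have h2 : ‖y‖ ^ 2 = ⟪f, toL2 (y.part (Icc (-N : ℤ) N)ᶜ)⟫_ℝ := by
      rw [← real_inner_self_eq_norm_sq, ← inner_adjL, ← inner_part_left, real_inner_comm]
    have h3 : ‖toL2 (y.part (Icc (-N : ℤ) N)ᶜ)‖ ≤ Real.sqrt (1 / ((N : ℝ) + 1)) * ‖y‖ := by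
      refine (sq_le_sq₀ (norm_nonneg _) (by positivity)).1 ?_
      rw [mul_pow, Real.sq_sqrt (by positivity), one_div, inv_mul_eq_div]
      exact norm_toL2_part_compl_sq_le N y
    have h4 : ‖y‖ ^ 2 ≤ ‖f‖ * (Real.sqrt (1 / ((N : ℝ) + 1)) * ‖y‖) :=
      h2.le.trans ((real_inner_le_norm _ _).trans (mul_le_mul_of_nonneg_left h3 (norm_nonneg _)))
    rw [h1, norm_neg]
    rcases (norm_nonneg y).eq_or_lt with h5 | h5
    · rw [← h5]; positivity
    · refine le_of_mul_le_mul_right ?_ h5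
      linarith
  exact isCompactOperator_of_tendsto hlim (Filter.Eventually.of_forall fun N =>
    (isCompactOperator_partL _).comp_clm (adjL n))

end E

end SymEH

/-! ### Analytic consequences of quadratic growth -/

namespace SymEH

open scoped NNReal

/-- `H ≥ 0` is continuous with globally Lipschitz gradient `g`, and up to bounded terms
`g z = 2 a z` and `H z ≥ 2 π |z|²`. -/
structure AsymptoticallyQuadratic {n : ℕ} (H : Phase n → ℝ) (g : Phase n → Phase n) (M : ℝ≥0)
    (C a : ℝ) : Prop where
  continuous : Continuous H
  nonneg : ∀ z, 0 ≤ H z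
  lipschitz_grad : LipschitzWith M g
  taylor : ∀ z w, |H (z + w) - H z - ⟪g z, w⟫_ℝ| ≤ M * ‖w‖ ^ 2
  norm_grad_sub_le : ∀ z, ‖g z - (2 * a) • z‖ ≤ C
  le_apply : ∀ z, 2 * Real.pi * ‖z‖ ^ 2 - C ≤ H z

/-- Subtracting the quadratic polynomial leaves a smooth function `f` of compact support, so `f` and
its derivative are bounded and the derivative is Lipschitz. -/
theorem exists_asymptoticallyQuadratic {n : ℕ} {H : Phase n → ℝ} (hsmooth : ContDiff ℝ ∞ H)
    (hnonneg : ∀ z, 0 ≤ H z) {z₀ : Phase n} {a b : ℝ} (ha : 2 * Real.pi < a)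
    (hquad : EqQuadraticOutsideCompact H z₀ a b) :
    ∃ g M C, AsymptoticallyQuadratic H g M C a := by
  obtain ⟨K, hK, hHK⟩ := hquad
  let q : Phase n → ℝ := fun z => a * ‖z‖ ^ 2 + ⟪z, z₀⟫_ℝ + b
  let f : Phase n → ℝ := fun z => H z - q z
  have hq : ContDiff ℝ ∞ q :=
    ((contDiff_const.mul (contDiff_norm_sq ℝ)).add (contDiff_id.inner ℝ contDiff_const)).add
      contDiff_const
  have hf : ContDiff ℝ ∞ f := hsmooth.sub hq
  have hfc : HasCompactSupport f := HasCompactSupport.intro hK fun z hz => by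
    simp only [f, q, hHK z hz, sub_self]
  have hf1 : ContDiff ℝ 1 (fderiv ℝ f) := hf.fderiv_right (by norm_cast)
  obtain ⟨L, hL⟩ := hf1.lipschitzWith_of_hasCompactSupport (hfc.fderiv ℝ) one_ne_zero
  obtain ⟨C₁, hC₁⟩ := (hfc.fderiv ℝ).exists_bound_of_continuous hf1.continuous
  obtain ⟨C₂, hC₂⟩ := hfc.exists_bound_of_continuous hf.continuous
  let g : Phase n → Phase n := fun z =>
    (2 * a) • z + z₀ + (InnerProductSpace.toDual ℝ (Phase n)).symm (fderiv ℝ f z)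
  have hHder : ∀ z, HasFDerivAt H (innerSL ℝ (g z)) z := fun z => by
    have h1 : HasFDerivAt f (fderiv ℝ f z) z := (hf.differentiable (by simp) z).hasFDerivAt
    have h2 : HasFDerivAt (fun z : Phase n => ⟪z, z₀⟫_ℝ) (innerSL ℝ z₀) z := by
      have := (innerSL ℝ z₀).hasFDerivAt (x := z)
      refine this.congr_of_eventuallyEq (Filter.Eventually.of_forall fun w => ?_)
      exact real_inner_comm _ _
    have h3 := (((((hasFDerivAt_id z).norm_sq).const_mul a).add h2).add_const b).add h1
    refine (h3.congr_of_eventuallyEq (Filter.Eventually.of_forall fun w => ?_)).congr_fderiv ?_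
    · simp [f, q]
    · ext w
      simp only [g, add_apply, smul_apply, ContinuousLinearMap.comp_apply, innerSL_apply_apply,
        inner_add_left, inner_smul_left, InnerProductSpace.toDual_symm_apply, id,
        ContinuousLinearMap.coe_id', smul_eq_mul, nsmul_eq_mul, conj_trivial]
      push_cast
      ring
  have hgL : LipschitzWith (Real.toNNReal (2 * |a|) + L) g := LipschitzWith.of_dist_le_mul
    fun z w => by
      have e : g z - g w = (2 * a) • (z - w) +
          (InnerProductSpace.toDual ℝ (Phase n)).symm (fderiv ℝ f z - fderiv ℝ f w) := by
        simp only [g, map_sub]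
        module
      rw [dist_eq_norm, e, NNReal.coe_add, Real.coe_toNNReal _ (by positivity), add_mul,
        dist_eq_norm]
      refine (norm_add_le _ _).trans (add_le_add ?_ ?_)
      · rw [norm_smul, Real.norm_eq_abs, abs_mul, abs_two]
      · rw [LinearIsometryEquiv.norm_map, ← dist_eq_norm, ← dist_eq_norm]
        exact hL.dist_le_mul z w
  obtain ⟨C₃, hC₃⟩ : ∃ C₃, ∀ z, 2 * Real.pi * ‖z‖ ^ 2 - C₃ ≤ H z := by
    have hd : 0 < a - 2 * Real.pi := by linarith
    -- Young's inequality absorbs the linear term `⟨z, z₀⟩` into the surplus `(a - 2π)|z|²`; `C₂`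
    -- bounds `f`.
    refine ⟨‖z₀‖ ^ 2 / (4 * (a - 2 * Real.pi)) - b + C₂, fun z => ?_⟩
    have h1 := neg_le_of_abs_le (hC₂ z)
    have h2 := neg_le_of_abs_le (abs_real_inner_le_norm z z₀)
    have h3 : H z = f z + (a * ‖z‖ ^ 2 + ⟪z, z₀⟫_ℝ + b) := by simp [f, q]
    have h4 : ‖z‖ * ‖z₀‖ ≤ (a - 2 * Real.pi) * ‖z‖ ^ 2 + ‖z₀‖ ^ 2 / (4 * (a - 2 * Real.pi)) := by
      have : ‖z₀‖ ^ 2 / (4 * (a - 2 * Real.pi)) * (4 * (a - 2 * Real.pi)) = ‖z₀‖ ^ 2 :=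
        div_mul_cancel₀ _ (by positivity)
      refine le_of_mul_le_mul_right ?_ (show 0 < 4 * (a - 2 * Real.pi) by positivity)
      rw [add_mul, this]
      nlinarith [sq_nonneg (2 * (a - 2 * Real.pi) * ‖z‖ - ‖z₀‖)]
    rw [h3]
    linarith
  refine ⟨g, Real.toNNReal (2 * |a|) + L, max (‖z₀‖ + C₁) C₃, hsmooth.continuous, hnonneg, hgL,
    fun z w => ?_, fun z => ?_, fun z => ?_⟩
  -- Mean value inequality on the ball of radius `‖w‖` about `z`, where the gradient varies by at
  -- most `M ‖w‖`.
  · have h := Convex.norm_image_sub_le_of_norm_hasFDerivWithin_le' (f := H)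
      (f' := fun z => innerSL ℝ (g z)) (φ := innerSL ℝ (g z)) (s := Metric.closedBall z ‖w‖)
      (x := z) (y := z + w) (C := (Real.toNNReal (2 * |a|) + L : ℝ≥0) * ‖w‖)
      (fun x _ => (hHder x).hasFDerivWithinAt) (fun x hx => ?_) (convex_closedBall _ _)
      (Metric.mem_closedBall_self (norm_nonneg _)) (by simp)
    · rw [add_sub_cancel_left, innerSL_apply_apply, Real.norm_eq_abs] at h
      rw [sq, ← mul_assoc]
      exact h
    · rw [← map_sub, innerSL_apply_norm, ← dist_eq_norm]
      exact (hgL.dist_le_mul x z).trans (mul_le_mul_of_nonneg_left hx (NNReal.coe_nonneg _))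
  · refine le_trans ?_ (le_max_left _ _)
    have e : g z - (2 * a) • z =
        z₀ + (InnerProductSpace.toDual ℝ (Phase n)).symm (fderiv ℝ f z) := by
      simp only [g]
      module
    rw [e]
    refine (norm_add_le _ _).trans (add_le_add le_rfl ?_)
    rw [LinearIsometryEquiv.norm_map]
    exact hC₁ z
  · exact (sub_le_sub_left (le_max_right _ _) _).trans (hC₃ z)

namespace AsymptoticallyQuadratic

variable {n : ℕ} {H : Phase n → ℝ} {g : Phase n → Phase n} {M : ℝ≥0} {C a : ℝ}

theorem const_nonneg (h : AsymptoticallyQuadratic H g M C a) : 0 ≤ C :=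
  (norm_nonneg _).trans (h.norm_grad_sub_le 0)

theorem apply_add_le (h : AsymptoticallyQuadratic H g M C a) (z w : Phase n) :
    H (z + w) ≤ H z + ‖g z‖ * ‖w‖ + M * ‖w‖ ^ 2 := by
  have h1 := (abs_le.1 (h.taylor z w)).2
  have h2 := real_inner_le_norm (g z) w
  linarith

theorem integrable_comp_add (h : AsymptoticallyQuadratic H g M C a) (z : Phase n)
    (f : L2Loop n) : Integrable (fun t => H (z + f t)) volume := by
  have h1 : Integrable (fun t => ‖f t‖) volume :=
    ((Lp.memLp f).integrable (by norm_num)).norm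
  have h2 : Integrable (fun t => ‖f t‖ ^ 2) volume := by
    simpa only [real_inner_self_eq_norm_sq] using L2.integrable_inner (𝕜 := ℝ) f f
  refine (((integrable_const (H z)).add (h1.const_mul ‖g z‖)).add
    (h2.const_mul (M : ℝ))).mono' ?_ ?_
  · exact h.continuous.comp_aestronglyMeasurable
      (aestronglyMeasurable_const.add (Lp.aestronglyMeasurable f))
  · refine Filter.Eventually.of_forall fun t => ?_
    rw [Real.norm_of_nonneg (h.nonneg _)]
    exact h.apply_add_le z (f t)

theorem integrable_comp (h : AsymptoticallyQuadratic H g M C a) (f : L2Loop n) :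
    Integrable (fun t => H (f t)) volume := by
  simpa using h.integrable_comp_add 0 f

theorem integral_norm_sq (f : L2Loop n) : ∫ t, ‖f t‖ ^ 2 = ‖f‖ ^ 2 := by
  simp only [← real_inner_self_eq_norm_sq, L2.inner_def]

theorem integrable_norm_sq (f : L2Loop n) : Integrable (fun t => ‖f t‖ ^ 2) volume := by
  simpa only [real_inner_self_eq_norm_sq] using L2.integrable_inner (𝕜 := ℝ) f f

theorem integral_nonneg (h : AsymptoticallyQuadratic H g M C a) (f : L2Loop n) :
    0 ≤ ∫ t, H (f t) := MeasureTheory.integral_nonneg fun _ => h.nonneg _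

theorem le_integral (h : AsymptoticallyQuadratic H g M C a) (f : L2Loop n) :
    2 * Real.pi * ‖f‖ ^ 2 - C ≤ ∫ t, H (f t) := by
  have h1 := integral_mono
    (((integrable_norm_sq f).const_mul (2 * Real.pi)).sub (integrable_const C))
    (h.integrable_comp f) fun t => h.le_apply (f t)
  rw [integral_sub' ((integrable_norm_sq f).const_mul _) (integrable_const C), integral_const_mul,
    integral_norm_sq, integral_const] at h1
  simpa [Measure.real, UnitAddCircle.measure_univ] using h1

theorem lipschitz_grad_sub (h : AsymptoticallyQuadratic H g M C a) :
    LipschitzWith M fun z => g z - g 0 :=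
  LipschitzWith.of_dist_le_mul fun x y => by
    rw [dist_sub_right]; exact h.lipschitz_grad.dist_le_mul x y

/-- The operator `f ↦ g ∘ f` on `L²`. -/
noncomputable def gradL2 (h : AsymptoticallyQuadratic H g M C a) (f : L2Loop n) : L2Loop n :=
  -- Composition with a Lipschitz map acts on `L²` only if the map fixes `0`, so the constant `g 0`
  -- is split off.
  h.lipschitz_grad_sub.compLp (sub_self _) f + Lp.const 2 volume (g 0)

theorem coeFn_gradL2 (h : AsymptoticallyQuadratic H g M C a) (f : L2Loop n) :
    h.gradL2 f =ᵐ[volume] fun t => g (f t) := by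
  filter_upwards [Lp.coeFn_add (h.lipschitz_grad_sub.compLp (sub_self _) f)
    (Lp.const 2 volume (g 0)), h.lipschitz_grad_sub.coeFn_compLp (sub_self _) f,
    Lp.coeFn_const 2 (volume : Measure UnitAddCircle) (g 0)] with t h1 h2 h3
  rw [gradL2, h1, Pi.add_apply, h2, h3]
  simp

theorem norm_gradL2_sub_le (h : AsymptoticallyQuadratic H g M C a) (f f' : L2Loop n) :
    ‖h.gradL2 f - h.gradL2 f'‖ ≤ M * ‖f - f'‖ := by
  rw [gradL2, gradL2, add_sub_add_right_eq_sub]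
  exact h.lipschitz_grad_sub.norm_compLp_sub_le (sub_self _) f f'

theorem norm_gradL2_sub_smul_le (h : AsymptoticallyQuadratic H g M C a) (f : L2Loop n) :
    ‖h.gradL2 f - (2 * a) • f‖ ≤ C := by
  refine (Lp.norm_le_of_ae_bound h.const_nonneg ?_).trans_eq (b := (measureUnivNNReal
    (volume : Measure UnitAddCircle) : ℝ) ^ (2 : ENNReal).toReal⁻¹ * C) ?_
  · filter_upwards [Lp.coeFn_sub (h.gradL2 f) ((2 * a) • f), Lp.coeFn_smul (2 * a) f,
      h.coeFn_gradL2 f] with t h1 h2 h3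
    rw [h1, Pi.sub_apply, h2, h3]
    exact h.norm_grad_sub_le (f t)
  · have : measureUnivNNReal (volume : Measure UnitAddCircle) = 1 := by
      simp [measureUnivNNReal]
    rw [this]
    simp

theorem abs_integral_taylor (h : AsymptoticallyQuadratic H g M C a) (f w : L2Loop n) :
    |(∫ t, H ((f + w) t)) - (∫ t, H (f t)) - ⟪h.gradL2 f, w⟫_ℝ| ≤ M * ‖w‖ ^ 2 := by
  rw [L2.inner_def, ← integral_sub' (h.integrable_comp _) (h.integrable_comp f),
    ← integral_sub' ((h.integrable_comp _).sub (h.integrable_comp f))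
      (L2.integrable_inner (𝕜 := ℝ) _ _), ← integral_norm_sq w, ← integral_const_mul,
    ← Real.norm_eq_abs]
  refine norm_integral_le_of_norm_le ((integrable_norm_sq w).const_mul _) ?_
  filter_upwards [Lp.coeFn_add f w, h.coeFn_gradL2 f] with t h1 h2
  rw [Pi.sub_apply, Pi.sub_apply, h1, h2, Pi.add_apply]
  exact h.taylor (f t) (w t)

/-- If `H` vanishes near `z`, then `∫ H(z + ε x) = o(ε²)`, uniformly on the unit ball of `𝔼`. -/
theorem exists_integral_add_smul_le (h : AsymptoticallyQuadratic H g M C a) {z : Phase n} {r : ℝ}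
    (hr : 0 < r) (hz : ∀ w, ‖w‖ < r → H (z + w) = 0) :
    ∃ ε : ℝ, 0 < ε ∧ ∀ x : E n, ‖x‖ ≤ 1 →
      ∫ t, H (z + ε • x.toL2 t) ≤ ε ^ 2 / 4 := by
  -- On `‖w‖ ≥ r` the linear term of the growth bound is dominated by a quadratic one.
  set K : ℝ := ‖g z‖ / r + M with hKdef
  have hK0 : 0 ≤ K := by positivity
  have hK : ∀ w, r ≤ ‖w‖ → H (z + w) ≤ K * ‖w‖ ^ 2 := fun w hw => by
    have h0 : H z = 0 := by simpa using hz 0 (by simpa using hr)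
    have h1 := h.apply_add_le z w
    have h2 : ‖g z‖ * ‖w‖ ≤ ‖g z‖ / r * ‖w‖ ^ 2 := by
      rw [div_mul_eq_mul_div, le_div_iff₀ hr, sq, ← mul_assoc]
      exact mul_le_mul_of_nonneg_left hw (by positivity)
    rw [hKdef, add_mul]
    linarith
  -- This turns the final bound `4 K ε² / (N + 1)` into at most `ε² / 4`.
  obtain ⟨N, hN⟩ := exists_nat_ge (16 * K)
  obtain ⟨D, hD0, hD⟩ := E.ae_norm_toL2_part_le (n := n) N
  -- With `2 D ε ≤ r`, wherever `H(z + ε x(t))` can be nonzero the low modes make up at most half of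
  -- `|x(t)|`. Hence `|x(t)| ≤ 2 |y(t)|` there, with `y` the tail.
  refine ⟨r / (2 * D + 1), by positivity, fun x hx => ?_⟩
  set ε := r / (2 * D + 1) with hε
  have hε0 : 0 < ε := by positivity
  have hεD : ε * (2 * D) ≤ r := by
    rw [hε, div_mul_eq_mul_div, div_le_iff₀ (by positivity)]
    nlinarith
  set y := x.part (Icc (-N : ℤ) N)ᶜ with hy
  have hsum : E.toL2 x = E.toL2 (x.part (Icc (-N : ℤ) N)) + E.toL2 y := by
    rw [← map_add, E.part_add_part_compl]
  have hpt : ∀ᵐ t, H (z + ε • x.toL2 t) ≤ 4 * K * ε ^ 2 * ‖E.toL2 y t‖ ^ 2 := by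
    filter_upwards [hD x, Lp.coeFn_add (E.toL2 (x.part (Icc (-N : ℤ) N))) (E.toL2 y)]
      with t h1 h2
    rcases lt_or_ge ‖ε • x.toL2 t‖ r with h3 | h3
    · rw [hz _ h3]; positivity
    · refine (hK _ h3).trans ?_
      rw [norm_smul, Real.norm_of_nonneg hε0.le] at h3 ⊢
      have h4 : ‖E.toL2 x t‖ ≤ ‖E.toL2 (x.part (Icc (-N : ℤ) N)) t‖ + ‖E.toL2 y t‖ := by
        rw [hsum, h2]
        exact norm_add_le _ _
      have h5 : 2 * D ≤ ‖E.toL2 x t‖ := le_of_mul_le_mul_left (hεD.trans h3) hε0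
      have h6 : D * ‖x‖ ≤ D := mul_le_of_le_one_right hD0 hx
      have h7 : ‖E.toL2 x t‖ ≤ 2 * ‖E.toL2 y t‖ := by linarith
      have h8 : ‖E.toL2 x t‖ ^ 2 ≤ (2 * ‖E.toL2 y t‖) ^ 2 := by gcongr
      calc K * (ε * ‖E.toL2 x t‖) ^ 2 = K * ε ^ 2 * ‖E.toL2 x t‖ ^ 2 := by ring
        _ ≤ K * ε ^ 2 * (2 * ‖E.toL2 y t‖) ^ 2 := by gcongr
        _ = _ := by ring
  have hae : (fun t => H (z + (ε • E.toL2 x : L2Loop n) t)) =ᵐ[volume]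
      fun t => H (z + ε • x.toL2 t) := by
    filter_upwards [Lp.coeFn_smul ε (E.toL2 x)] with t ht
    rw [ht, Pi.smul_apply]
  have hI := (h.integrable_comp_add z (ε • E.toL2 x)).congr hae
  refine (integral_mono_ae hI ((integrable_norm_sq (E.toL2 y)).const_mul _) hpt).trans ?_
  rw [integral_const_mul, integral_norm_sq]
  have h9 := E.norm_toL2_part_compl_sq_le N x
  rw [← hy] at h9
  have h10 : ‖x‖ ^ 2 ≤ 1 := pow_le_one₀ (norm_nonneg _) hx
  calc 4 * K * ε ^ 2 * ‖E.toL2 y‖ ^ 2 ≤ 4 * K * ε ^ 2 * (1 / (N + 1)) := by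
        gcongr
        exact h9.trans (by gcongr)
    _ ≤ ε ^ 2 / 4 := by
        rw [mul_one_div, div_le_iff₀ (by positivity)]
        nlinarith [sq_nonneg ε]

end AsymptoticallyQuadratic

end SymEH

/-! ### Gradient of the action and the Palais–Smale condition -/

namespace SymEH

open scoped NNReal
open Filter Topology

namespace E

variable {n : ℕ}

theorem inner_plus_plus (x y : E n) : ⟪x.plus, y.plus⟫_ℝ = ⟪x.plus, y⟫_ℝ := by
  rw [plus, plus, ← inner_part_left, part_part, inter_self]

theorem inner_minus_minus (x y : E n) : ⟪x.minus, y.minus⟫_ℝ = ⟪x.minus, y⟫_ℝ := by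
  rw [minus, minus, ← inner_part_left, part_part, inter_self]

theorem plus_add (x y : E n) : (x + y).plus = x.plus + y.plus := map_add (partL n _) x y

theorem minus_add (x y : E n) : (x + y).minus = x.minus + y.minus := map_add (partL n _) x y

theorem plus_sub (x y : E n) : (x - y).plus = x.plus - y.plus := map_sub (partL n _) x y

theorem minus_sub (x y : E n) : (x - y).minus = x.minus - y.minus := map_sub (partL n _) x y

theorem norm_plus_le (x : E n) : ‖x.plus‖ ≤ ‖x‖ := norm_part_le _ x

theorem norm_minus_le (x : E n) : ‖x.minus‖ ≤ ‖x‖ := norm_part_le _ x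

theorem norm_zero_le (x : E n) : ‖x.zero‖ ≤ ‖x‖ := norm_part_le _ x

theorem continuous_plus : Continuous (plus : E n → E n) := (partL n _).continuous

theorem continuous_zero : Continuous (zero : E n → E n) := (partL n _).continuous

theorem continuous_minus : Continuous (minus : E n → E n) := (partL n _).continuous

/-- The gradient of the action functional of `z ↦ a |z|²`. -/
noncomputable def quadraticGrad (n : ℕ) (a : ℝ) : E n →L[ℝ] E n :=
  partL n {j | 0 < j} - partL n {j | j < 0} - (2 * a) • (adjL n).comp (toL2L n)

theorem quadraticGrad_apply (a : ℝ) (x : E n) :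
    quadraticGrad n a x = x.plus - x.minus - (2 * a) • adjL n (toL2 x) := rfl

/-- The number `a` lies strictly between consecutive multiples `N π` and `(N + 1) π`. The constant
`δ` is the smaller of the two relative gaps, capped at `1` for use with the modes `j ≤ 0`. -/
theorem exists_gap {a : ℝ} (ha : 2 * Real.pi < a) (hres : ∀ k : ℤ, a ≠ k * Real.pi) :
    ∃ δ : ℝ, 0 < δ ∧ δ ≤ 1 ∧
      (∀ j : ℤ, 0 < j → (j : ℝ) * Real.pi < a → (1 + δ) * (j * Real.pi) ≤ a) ∧
      ∀ j : ℤ, 0 < j → a < j * Real.pi → a ≤ (1 - δ) * (j * Real.pi) := by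
  have hpi := Real.pi_pos
  set N : ℤ := ⌊a / Real.pi⌋ with hN
  have h2 : (2 : ℤ) ≤ N := Int.le_floor.2 (by rw [le_div_iff₀ hpi]; exact_mod_cast ha.le)
  have hNr : (0 : ℝ) < N := by exact_mod_cast (by omega : 0 < N)
  have hNa : N * Real.pi < a := by
    refine lt_of_le_of_ne ?_ (hres N).symm
    rw [← le_div_iff₀ hpi]
    exact Int.floor_le _
  have haN : a < (N + 1) * Real.pi := by
    rw [← div_lt_iff₀ hpi]
    exact Int.lt_floor_add_one _
  have hd1 : 0 < N * Real.pi := by positivity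
  have hd2 : 0 < (N + 1) * Real.pi := by positivity
  refine ⟨min (min (a / (N * Real.pi) - 1) (1 - a / ((N + 1) * Real.pi))) 1, ?_, min_le_right _ _,
    fun j hj hja => ?_, fun j hj hja => ?_⟩
  · refine lt_min (lt_min ?_ ?_) one_pos
    · rw [sub_pos, lt_div_iff₀ hd1]; linarith
    · rw [sub_pos, div_lt_iff₀ hd2]; linarith
  · set δ := min (min (a / (N * Real.pi) - 1) (1 - a / ((N + 1) * Real.pi))) 1
    have h1 : δ ≤ a / (N * Real.pi) - 1 := (min_le_left _ _).trans (min_le_left _ _)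
    have hjN : (j : ℝ) ≤ N := by
      exact_mod_cast Int.le_floor.2 ((le_div_iff₀ hpi).2 hja.le)
    have hj0 : (0 : ℝ) < j := by exact_mod_cast hj
    have h3 : a / (N * Real.pi) * (N * Real.pi) = a := div_mul_cancel₀ _ hd1.ne'
    calc (1 + δ) * (j * Real.pi) ≤ a / (N * Real.pi) * (N * Real.pi) := by
          refine mul_le_mul (by linarith) (by gcongr) (by positivity) ?_
          have : 0 < a := by linarith
          positivity
      _ = a := h3
  · set δ := min (min (a / (N * Real.pi) - 1) (1 - a / ((N + 1) * Real.pi))) 1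
    have h1 : δ ≤ 1 - a / ((N + 1) * Real.pi) := (min_le_left _ _).trans (min_le_right _ _)
    have hjN : (N : ℝ) + 1 ≤ j := by
      have : N < j := Int.floor_lt.2 ((div_lt_iff₀ hpi).2 hja)
      exact_mod_cast this
    have h3 : a / ((N + 1) * Real.pi) * ((N + 1) * Real.pi) = a := div_mul_cancel₀ _ hd2.ne'
    have ha0 : 0 < a := by linarith
    calc a = a / ((N + 1) * Real.pi) * ((N + 1) * Real.pi) := h3.symm
      _ ≤ (1 - δ) * (j * Real.pi) := by
          have h4 : a / ((N + 1) * Real.pi) ≤ 1 - δ := by linarith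
          have h5 : 0 ≤ a / ((N + 1) * Real.pi) := by positivity
          exact mul_le_mul h4 (by gcongr) (by positivity) (h5.trans h4)

/-- The operator is diagonal in the modes, with factor `1 - a / (jπ)` for `j > 0`, `-2a` for `j = 0`
and `-1 - a / (|j|π)` for `j < 0`. Nonresonance keeps these away from `0`. -/
theorem exists_le_norm_quadraticGrad {a : ℝ} (ha : 2 * Real.pi < a)
    (hres : ∀ k : ℤ, a ≠ k * Real.pi) :
    ∃ δ : ℝ, 0 < δ ∧ ∀ x : E n, δ * ‖x‖ ≤ ‖quadraticGrad n a x‖ := by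
  obtain ⟨δ, hδ, hδ1, hlo, hhi⟩ := exists_gap ha hres
  refine ⟨δ, hδ, fun x => ?_⟩
  have hpi := Real.pi_gt_three
  let B : Set ℤ := {j | a < j * Real.pi}
  -- Reversing the sign of the modes with negative factor makes every term of `⟨quadraticGrad x, y⟩`
  -- nonnegative without changing the norm.
  let y : E n := x.part B - x.part Bᶜ
  have hyB : ∀ j ∈ B, y.coef j = x.coef j := fun j hj => by
    simp only [y, coef_sub]
    rw [coef_part_of_mem x hj, coef_part_of_notMem x (not_not.2 hj), sub_zero]
  have hyBc : ∀ j ∉ B, y.coef j = -x.coef j := fun j hj => by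
    simp only [y, coef_sub]
    rw [coef_part_of_notMem x hj, coef_part_of_mem x hj, zero_sub]
  have hy : ‖y‖ = ‖x‖ := by
    refine (sq_eq_sq₀ (norm_nonneg _) (norm_nonneg _)).1 ?_
    refine (hasSum_norm_sq y).unique ((hasSum_norm_sq x).congr_fun fun j => ?_)
    by_cases hj : j ∈ B
    · rw [hyB j hj]
    · rw [hyBc j hj, norm_neg]
  have hin : ⟪quadraticGrad n a x, y⟫_ℝ =
      ⟪x.plus, y⟫_ℝ - ⟪x.minus, y⟫_ℝ - 2 * a * ⟪toL2 x, toL2 y⟫_ℝ := by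
    rw [quadraticGrad_apply, inner_sub_left, inner_sub_left, real_inner_smul_left, inner_adjL]
  have hsum := ((hasSum_inner x.plus y).sub (hasSum_inner x.minus y)).sub
    ((hasSum_inner_toL2 x y).mul_left (2 * a))
  rw [← hin] at hsum
  have hle : δ * ‖x‖ ^ 2 ≤ ⟪quadraticGrad n a x, y⟫_ℝ := by
    refine hasSum_le (fun j => ?_) ((hasSum_norm_sq x).mul_left δ) hsum
    have hs := sq_nonneg ‖x.coef j‖
    rcases lt_trichotomy j 0 with hj | rfl | hj
    · have hjB : j ∉ B := fun h => by
        have h1 : a < j * Real.pi := h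
        have h2 : (j : ℝ) < 0 := by exact_mod_cast hj
        nlinarith
      have h1 : x.plus.coef j = 0 := coef_part_of_notMem x (not_lt.2 hj.le)
      have h2 : x.minus.coef j = x.coef j := coef_part_of_mem x hj
      rw [hyBc j hjB, h1, h2]
      simp only [inner_neg_right, inner_zero_left, real_inner_self_eq_norm_sq]
      have h3 := mul_nonneg (weight_pos j).le hs
      nlinarith
    · have hjB : (0 : ℤ) ∉ B := fun h => by
        have h1 : a < ((0 : ℤ) : ℝ) * Real.pi := h
        simp at h1
        linarith
      have h1 : x.plus.coef 0 = 0 := coef_part_of_notMem x (by simp)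
      have h2 : x.minus.coef 0 = 0 := coef_part_of_notMem x (by simp)
      rw [hyBc 0 hjB, h1, h2, weight_zero]
      simp only [inner_neg_right, inner_zero_left, real_inner_self_eq_norm_sq]
      nlinarith
    · have h1 : x.plus.coef j = x.coef j := coef_part_of_mem x hj
      have h2 : x.minus.coef j = 0 := coef_part_of_notMem x (not_lt.2 hj.le)
      have hj0 : (0 : ℝ) < j := by exact_mod_cast hj
      rw [h1, h2, weight_of_ne hj.ne', abs_of_pos hj0]
      rcases (hres j).lt_or_gt with h | h
      · rw [hyB j h]
        simp only [inner_zero_left, real_inner_self_eq_norm_sq]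
        have h3 := hhi j hj h
        nlinarith
      · rw [hyBc j (not_lt.2 h.le)]
        simp only [inner_neg_right, inner_zero_left, real_inner_self_eq_norm_sq]
        have h3 := hlo j hj h
        nlinarith
  have hcs := real_inner_le_norm (quadraticGrad n a x) y
  rw [hy] at hcs
  rcases (norm_nonneg x).eq_or_lt with h0 | h0
  · rw [← h0]; simp
  · refine le_of_mul_le_mul_right ?_ h0
    rw [mul_assoc, ← sq]
    exact hle.trans hcs

end E

namespace AsymptoticallyQuadratic

variable {n : ℕ} {H : Phase n → ℝ} {g : Phase n → Phase n} {M : ℝ≥0} {C a : ℝ}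

open E

/-- The gradient of `Φ_H` with respect to `⟨·, ·⟩_{1/2}`. -/
noncomputable def gradAction (h : AsymptoticallyQuadratic H g M C a) (x : E n) : E n :=
  x.plus - x.minus - adjL n (h.gradL2 (toL2 x))

/-- The quadratic part has exact remainder `½(‖y⁺‖² - ‖y⁻‖²)`, and the integral contributes at most
`M ‖y‖²`. The uniform bound yields both differentiability and the increase along an Euler step. -/
theorem abs_action_add_sub_le (h : AsymptoticallyQuadratic H g M C a) (x y : E n) :
    |action H (x + y) - action H x - ⟪h.gradAction x, y⟫_ℝ| ≤ (M + 1) * ‖y‖ ^ 2 := by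
  have h1 := h.abs_integral_taylor (toL2 x) (toL2 y)
  have hp : ‖(x + y).plus‖ ^ 2 = ‖x.plus‖ ^ 2 + 2 * ⟪x.plus, y⟫_ℝ + ‖y.plus‖ ^ 2 := by
    rw [plus_add, norm_add_sq_real, inner_plus_plus]
  have hm : ‖(x + y).minus‖ ^ 2 = ‖x.minus‖ ^ 2 + 2 * ⟪x.minus, y⟫_ℝ + ‖y.minus‖ ^ 2 := by
    rw [minus_add, norm_add_sq_real, inner_minus_minus]
  have hin : ⟪h.gradAction x, y⟫_ℝ =
      ⟪x.plus, y⟫_ℝ - ⟪x.minus, y⟫_ℝ - ⟪h.gradL2 (toL2 x), toL2 y⟫_ℝ := by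
    rw [gradAction, inner_sub_left, inner_sub_left, inner_adjL]
  have hL : (M : ℝ) * ‖toL2 y‖ ^ 2 ≤ M * ‖y‖ ^ 2 := by
    gcongr
    exact norm_toL2_le y
  have h3 := norm_sq_eq y
  have h4 := sq_nonneg ‖y.plus‖
  have h5 := sq_nonneg ‖y.minus‖
  have h6 := sq_nonneg ‖y.zero‖
  rw [action, action, map_add, hp, hm, hin]
  rw [abs_le] at h1 ⊢
  constructor <;> linarith [h1.1, h1.2]

theorem hasFDerivAt_action (h : AsymptoticallyQuadratic H g M C a) (x : E n) :
    HasFDerivAt (action H) (innerSL ℝ (h.gradAction x)) x := by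
  rw [hasFDerivAt_iff_isLittleO_nhds_zero]
  have hO : (fun y => action H (x + y) - action H x - innerSL ℝ (h.gradAction x) y) =O[𝓝 0]
      fun y : E n => ‖y‖ ^ 2 := by
    refine Asymptotics.IsBigO.of_bound (M + 1) (Eventually.of_forall fun y => ?_)
    rw [innerSL_apply_apply, Real.norm_eq_abs, norm_pow, norm_norm]
    exact h.abs_action_add_sub_le x y
  exact hO.trans_isLittleO (Asymptotics.isLittleO_norm_pow_id one_lt_two)

theorem continuous_action (h : AsymptoticallyQuadratic H g M C a) :
    Continuous (action H : E n → ℝ) :=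
  continuous_iff_continuousAt.2 fun x => (h.hasFDerivAt_action x).continuousAt

theorem norm_gradAction_sub_le (h : AsymptoticallyQuadratic H g M C a) (x y : E n) :
    ‖h.gradAction x - h.gradAction y‖ ≤ (M + 2) * ‖x - y‖ := by
  have e : h.gradAction x - h.gradAction y = (x - y).plus - (x - y).minus -
      adjL n (h.gradL2 (toL2 x) - h.gradL2 (toL2 y)) := by
    rw [gradAction, gradAction, plus_sub, minus_sub, map_sub]
    abel
  rw [e]
  refine (norm_sub_le _ _).trans ?_
  have h1 := norm_sub_le (x - y).plus (x - y).minus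
  have h2 := (norm_adjL_le (h.gradL2 (toL2 x) - h.gradL2 (toL2 y))).trans
    (h.norm_gradL2_sub_le _ _)
  rw [← map_sub] at h2
  have h3 := mul_le_mul_of_nonneg_left (norm_toL2_le (x - y)) M.2
  have h4 := norm_plus_le (x - y)
  have h5 := norm_minus_le (x - y)
  change (M : ℝ) * _ ≤ M * _ at h3
  linarith

theorem continuous_gradAction (h : AsymptoticallyQuadratic H g M C a) :
    Continuous h.gradAction := by
  refine (LipschitzWith.of_dist_le_mul (K := M + 2) fun x y => ?_).continuous
  rw [dist_eq_norm, dist_eq_norm]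
  exact_mod_cast h.norm_gradAction_sub_le x y

theorem isCriticalValue_of_gradAction_eq_zero (h : AsymptoticallyQuadratic H g M C a) {x : E n}
    (hx : h.gradAction x = 0) : IsCriticalValue H (action H x) := by
  refine ⟨x, ?_, rfl⟩
  have := h.hasFDerivAt_action x
  rwa [hx, map_zero] at this

/-- The Palais–Smale condition, in quantitative form at a regular value. -/
theorem exists_le_norm_gradAction (h : AsymptoticallyQuadratic H g M C a)
    (ha : 2 * Real.pi < a) (hres : ∀ k : ℤ, a ≠ k * Real.pi) {c : ℝ}
    (hc : ¬ IsCriticalValue H c) :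
    ∃ ε : ℝ, 0 < ε ∧ ∀ x : E n, |action H x - c| < ε → ε ≤ ‖h.gradAction x‖ := by
  by_contra! hcon
  have hpos : ∀ k : ℕ, (0 : ℝ) < 1 / ((k : ℝ) + 1) := fun k => by positivity
  choose x hxc hxg using fun k : ℕ => hcon (1 / ((k : ℝ) + 1)) (hpos k)
  obtain ⟨δ, hδ, hA⟩ := exists_le_norm_quadraticGrad (n := n) ha hres
  obtain ⟨K, hK, hsub⟩ :=
    (isCompactOperator_adjL (n := n)).image_closedBall_subset_compact (f := (adjL n : L2Loop n →ₗ[ℝ] E n)) C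
  -- The deviation from the linearisation is the image under the compact operator `adjL` of a set
  -- bounded by `C` in `L²`. Along a sequence with gradients tending to `0` it converges on a
  -- subsequence, and so does `quadraticGrad`, which is bounded below and thus lets the points
  -- themselves converge.
  let κ : E n → E n := fun x => adjL n (h.gradL2 (toL2 x) - (2 * a) • toL2 x)
  have hκ : ∀ x, quadraticGrad n a x = h.gradAction x + κ x := fun x => by
    simp only [κ, quadraticGrad_apply, gradAction, map_sub, map_smul]
    abel
  obtain ⟨y, -, φ, hφ, hy⟩ := hK.tendsto_subseq (x := fun k => κ (x k)) fun k =>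
    hsub ⟨_, mem_closedBall_zero_iff.2 (h.norm_gradL2_sub_smul_le _), rfl⟩
  have h0 : Tendsto (fun k : ℕ => 1 / ((k : ℝ) + 1)) atTop (𝓝 0) :=
    tendsto_one_div_add_atTop_nhds_zero_nat
  have hg0 : Tendsto (fun k => h.gradAction (x k)) atTop (𝓝 0) :=
    squeeze_zero_norm (fun k => (hxg k).le) h0
  have hAx : Tendsto (fun k => quadraticGrad n a (x (φ k))) atTop (𝓝 y) := by
    have := (hg0.comp hφ.tendsto_atTop).add hy
    rw [zero_add] at this
    exact this.congr fun k => (hκ _).symm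
  have hanti : AntilipschitzWith (Real.toNNReal δ⁻¹) (quadraticGrad n a) :=
    AddMonoidHomClass.antilipschitz_of_bound _ fun z => by
      rw [Real.coe_toNNReal _ (by positivity), ← div_eq_inv_mul, le_div_iff₀ hδ, mul_comm]
      exact hA z
  obtain ⟨z, rfl⟩ := (hanti.isClosed_range (quadraticGrad n a).uniformContinuous).mem_of_tendsto
    hAx (Eventually.of_forall fun k => mem_range_self _)
  have hxz : Tendsto (fun k => x (φ k)) atTop (𝓝 z) :=
    (hanti.isUniformEmbedding (quadraticGrad n a).uniformContinuous).isEmbedding.tendsto_nhds_iff.2 hAx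
  refine hc ?_
  have h1 : h.gradAction z = 0 := tendsto_nhds_unique
    ((h.continuous_gradAction.tendsto z).comp hxz) (hg0.comp hφ.tendsto_atTop)
  have h2 : action H z = c := by
    refine tendsto_nhds_unique ((h.continuous_action.tendsto z).comp hxz) ?_
    have h3 : Tendsto (fun k => action H (x k) - c) atTop (𝓝 0) :=
      squeeze_zero_norm (fun k => (hxc k).le) h0
    have h4 := (h3.comp hφ.tendsto_atTop).add_const c
    rw [zero_add] at h4
    exact h4.congr fun k => sub_add_cancel _ _
  rw [← h2]
  exact h.isCriticalValue_of_gradAction_eq_zero h1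

end AsymptoticallyQuadratic

end SymEH

/-! ### Admissible deformations and their composition -/

namespace SymEH

open scoped NNReal
open Filter Topology

namespace E

variable {n : ℕ}

theorem part_part_of_disjoint {A B : Set ℤ} (h : Disjoint B A) (x : E n) :
    (x.part A).part B = 0 := by
  rw [part_part, h.inter_eq, part_empty]

theorem plus_plus (x : E n) : x.plus.plus = x.plus := by rw [plus, plus, part_part, inter_self]

theorem zero_zero (x : E n) : x.zero.zero = x.zero := by rw [zero, zero, part_part, inter_self]

theorem minus_minus (x : E n) : x.minus.minus = x.minus := by
  rw [minus, minus, part_part, inter_self]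

theorem plus_zero (x : E n) : x.zero.plus = 0 :=
  part_part_of_disjoint (by simp) x

theorem plus_minus (x : E n) : x.minus.plus = 0 :=
  part_part_of_disjoint (by rw [disjoint_left]; intro j h1 h2; simp only [mem_ofPred_eq] at h1 h2; omega) x

theorem zero_plus (x : E n) : x.plus.zero = 0 :=
  part_part_of_disjoint (by simp) x

theorem zero_minus (x : E n) : x.minus.zero = 0 :=
  part_part_of_disjoint (by simp) x

theorem minus_plus (x : E n) : x.plus.minus = 0 :=
  part_part_of_disjoint (by rw [disjoint_left]; intro j h1 h2; simp only [mem_ofPred_eq] at h1 h2; omega) x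

theorem minus_zero (x : E n) : x.zero.minus = 0 :=
  part_part_of_disjoint (by simp) x

theorem zero_add (x y : E n) : (x + y).zero = x.zero + y.zero := map_add (partL n _) x y

theorem plus_smul (r : ℝ) (x : E n) : (r • x).plus = r • x.plus := map_smul (partL n _) r x

theorem zero_smul (r : ℝ) (x : E n) : (r • x).zero = r • x.zero := map_smul (partL n _) r x

theorem minus_smul (r : ℝ) (x : E n) : (r • x).minus = r • x.minus := map_smul (partL n _) r x

end E

open E

/-- The data `(a, b, c, k)` of an affine map `x ↦ a x⁺ + b x⁰ + c x⁻ + k` with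
`a, b, c > 0`. -/
abbrev Coeffs (n : ℕ) : Type := Ioi (0 : ℝ) × Ioi (0 : ℝ) × Ioi (0 : ℝ) × E n

namespace Coeffs

variable {n : ℕ}

/-- The affine map with the given data. -/
noncomputable def eval (T : Coeffs n) (x : E n) : E n :=
  (T.1 : ℝ) • x.plus + (T.2.1 : ℝ) • x.zero + (T.2.2.1 : ℝ) • x.minus + T.2.2.2

/-- The product of positive numbers. -/
noncomputable def mulPos (s t : Ioi (0 : ℝ)) : Ioi (0 : ℝ) :=
  ⟨s * t, mem_Ioi.2 (mul_pos (mem_Ioi.1 s.2) (mem_Ioi.1 t.2))⟩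

theorem coe_mulPos (s t : Ioi (0 : ℝ)) : (mulPos s t : ℝ) = s * t := rfl

theorem continuous_mulPos : Continuous fun p : Ioi (0 : ℝ) × Ioi (0 : ℝ) => mulPos p.1 p.2 :=
  Continuous.subtype_mk (by fun_prop) _

/-- The data of the composition. -/
noncomputable def comp (S T : Coeffs n) : Coeffs n :=
  (mulPos S.1 T.1, mulPos S.2.1 T.2.1, mulPos S.2.2.1 T.2.2.1, S.eval T.2.2.2)

theorem eval_comp (S T : Coeffs n) (x : E n) : (S.comp T).eval x = S.eval (T.eval x) := by
  simp only [eval, comp, coe_mulPos, plus_add, E.zero_add, minus_add, plus_smul, E.zero_smul, minus_smul,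
    plus_plus, zero_zero, minus_minus, E.plus_zero, plus_minus, zero_plus, zero_minus, minus_plus,
    E.minus_zero, smul_zero, add_zero, _root_.zero_add, smul_add, mul_smul]
  abel

theorem continuous_eval : Continuous fun p : Coeffs n × E n => p.1.eval p.2 := by
  unfold eval
  have h1 := continuous_plus (n := n)
  have h2 := continuous_zero (n := n)
  have h3 := continuous_minus (n := n)
  fun_prop

theorem continuous_comp : Continuous fun p : Coeffs n × Coeffs n => p.1.comp p.2 := by
  unfold comp
  have h := continuous_eval (n := n)
  have h' : Continuous fun p : Coeffs n × Coeffs n => p.1.eval p.2.2.2.2 :=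
    h.comp₂ continuous_fst (by fun_prop)
  have h1 : Continuous fun p : Coeffs n × Coeffs n => mulPos p.1.1 p.2.1 :=
    continuous_mulPos.comp (by fun_prop : Continuous fun p : Coeffs n × Coeffs n => (p.1.1, p.2.1))
  have h2 : Continuous fun p : Coeffs n × Coeffs n => mulPos p.1.2.1 p.2.2.1 :=
    continuous_mulPos.comp
      (by fun_prop : Continuous fun p : Coeffs n × Coeffs n => (p.1.2.1, p.2.2.1))
  have h3 : Continuous fun p : Coeffs n × Coeffs n => mulPos p.1.2.2.1 p.2.2.2.1 :=
    continuous_mulPos.comp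
      (by fun_prop : Continuous fun p : Coeffs n × Coeffs n => (p.1.2.2.1, p.2.2.2.1))
  exact h1.prodMk (h2.prodMk (h3.prodMk h'))

/-- Compactness is meant inside `(0, ∞)³ × 𝔼`, so the scalars need a positive lower bound as well as
an upper one. -/
theorem isCompact_closure_of_subset {Y : Type*} {T : Y → Coeffs n} {B : Set Y} {l u : ℝ}
    (hl : 0 < l) {K : Set (E n)} (hK : IsCompact K)
    (h : ∀ y ∈ B, ((T y).1 : ℝ) ∈ Icc l u ∧ ((T y).2.1 : ℝ) ∈ Icc l u ∧
      ((T y).2.2.1 : ℝ) ∈ Icc l u ∧ (T y).2.2.2 ∈ K) : IsCompact (closure (T '' B)) := by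
  have hI : IsCompact ((Subtype.val : Ioi (0 : ℝ) → ℝ) ⁻¹' Icc l u) := by
    refine Topology.IsInducing.subtypeVal.isCompact_preimage_iff ?_ |>.2 isCompact_Icc
    rw [Subtype.range_coe]
    exact fun x hx => hl.trans_le hx.1
  refine (hI.prod (hI.prod (hI.prod hK))).closure_of_subset ?_
  rintro _ ⟨y, hy, rfl⟩
  obtain ⟨h1, h2, h3, h4⟩ := h y hy
  exact ⟨h1, h2, h3, h4⟩

theorem isBounded_eval {Y : Type*} {T : Y → Coeffs n} {B : Set Y} {f : Y → E n}
    (hT : IsCompact (closure (T '' B))) (hf : Bornology.IsBounded (f '' B)) :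
    Bornology.IsBounded ((fun y => (T y).eval (f y)) '' B) := by
  obtain ⟨R, hR⟩ := hT.exists_bound_of_continuousOn
    (f := fun S : Coeffs n => ((S.1 : ℝ), (S.2.1 : ℝ), (S.2.2.1 : ℝ), S.2.2.2))
    (by fun_prop : Continuous _).continuousOn
  obtain ⟨r, hr⟩ := hf.exists_norm_le
  refine isBounded_iff_forall_norm_le.2 ⟨R * r + R * r + R * r + R, ?_⟩
  rintro _ ⟨y, hy, rfl⟩
  have h1 := hR _ (subset_closure (mem_image_of_mem T hy))
  simp only [Prod.norm_def, sup_le_iff] at h1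
  obtain ⟨ha, hb, hc, hK⟩ := h1
  have hx := hr _ (mem_image_of_mem f hy)
  have hR0 := (norm_nonneg _).trans ha
  have key : ∀ (s : ℝ) (z : E n), ‖s‖ ≤ R → ‖z‖ ≤ ‖f y‖ → ‖s • z‖ ≤ R * r := fun s z hs hz => by
    rw [norm_smul]
    exact mul_le_mul hs (hz.trans hx) (norm_nonneg _) hR0
  exact (norm_add_le _ _).trans (add_le_add ((norm_add_le _ _).trans (add_le_add
    ((norm_add_le _ _).trans (add_le_add (key _ _ ha (norm_plus_le _))
      (key _ _ hb (norm_zero_le _)))) (key _ _ hc (norm_minus_le _)))) hK)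

end Coeffs

variable {n : ℕ}

/-- The homotopy and its continuity are determined by the coefficient map `T`, and the complement of
`𝔼⁻ ⊕ 𝔼⁰` is the set where `x⁺ ≠ 0`. -/
theorem isAdmissible_iff {γ : E n → E n} : IsAdmissible γ ↔
    ∃ T : E n × unitInterval → Coeffs n, Continuous T ∧
      (∀ B, Bornology.IsBounded B → IsCompact (closure (T '' B))) ∧
      (∀ x, (T (x, 0)).eval x = x) ∧ (∀ x, (T (x, 1)).eval x = γ x) ∧
      ∀ u, (fun x => (T (x, u)).eval x) '' {x | x.plus ≠ 0} = {x | x.plus ≠ 0} := by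
  have hcompl : ((Eminus n ⊔ Ezero n : Submodule ℝ (E n)) : Set (E n))ᶜ = {x | x.plus ≠ 0} := by
    ext x
    exact not_congr mem_Eminus_sup_Ezero_iff
  constructor
  · rintro ⟨-, G, -, h0, h1, himg, a, b, c, K, hT, hB, hG⟩
    refine ⟨fun p => (a p, b p, c p, K p), hT, hB, fun x => ?_, fun x => ?_, fun u => ?_⟩
    · exact (hG x 0).symm.trans (by rw [h0]; rfl)
    · exact (hG x 1).symm.trans (by rw [h1])
    · rw [← hcompl]
      have hGu : (fun x => Coeffs.eval (a (x, u), b (x, u), c (x, u), K (x, u)) x) = G u :=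
        funext fun x => (hG x u).symm
      rw [hGu]
      exact himg u
  · rintro ⟨T, hT, hB, h0, h1, himg⟩
    have hG : Continuous fun p : E n × unitInterval => (T p).eval p.1 :=
      Coeffs.continuous_eval.comp₂ hT continuous_fst
    refine ⟨?_, fun u x => (T (x, u)).eval x, hG, funext h0, funext h1, fun u => ?_,
      fun p => (T p).1, fun p => (T p).2.1, fun p => (T p).2.2.1, fun p => (T p).2.2.2, hT, hB,
      fun x u => rfl⟩
    · have : γ = fun x => (T (x, 1)).eval x := funext fun x => (h1 x).symm
      rw [this]
      exact Coeffs.continuous_eval.comp₂ (hT.comp (by fun_prop)) continuous_id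
    · rw [hcompl]
      exact himg u

/-- Maps of the form `a x⁺ + b x⁰ + c x⁻ + k` compose within that form, with translation part
`S.eval k`. Bounded sets stay bounded under the first homotopy, so the second is applied where its
coefficients are still relatively compact. -/
theorem IsAdmissible.comp {ψ γ : E n → E n} (hψ : IsAdmissible ψ) (hγ : IsAdmissible γ) :
    IsAdmissible (ψ ∘ γ) := by
  obtain ⟨S, hS, hSB, hS0, hS1, hSi⟩ := isAdmissible_iff.1 hψ
  obtain ⟨T, hT, hTB, hT0, hT1, hTi⟩ := isAdmissible_iff.1 hγ
  let q : E n × unitInterval → E n × unitInterval := fun p => ((T p).eval p.1, p.2)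
  have hq : Continuous q :=
    (Coeffs.continuous_eval.comp₂ hT continuous_fst).prodMk continuous_snd
  refine isAdmissible_iff.2 ⟨fun p => (S (q p)).comp (T p), ?_, fun B hB => ?_, fun x => ?_,
    fun x => ?_, fun u => ?_⟩
  · exact Coeffs.continuous_comp.comp₂ (hS.comp hq) hT
  · have hqB : Bornology.IsBounded (q '' B) := by
      have h1 : Bornology.IsBounded ((fun p => (T p).eval p.1) '' B) :=
        Coeffs.isBounded_eval (hTB B hB) (Bornology.isBounded_image_fst_and_snd.2 hB).1
      refine (h1.prod (Bornology.isBounded_image_fst_and_snd.2 hB).2).subset ?_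
      rintro _ ⟨p, hp, rfl⟩
      exact ⟨mem_image_of_mem _ hp, p, hp, rfl⟩
    refine (((hSB _ hqB).prod (hTB B hB)).image Coeffs.continuous_comp).closure_of_subset ?_
    rintro _ ⟨p, hp, rfl⟩
    exact ⟨(S (q p), T p), ⟨subset_closure ⟨q p, ⟨p, hp, rfl⟩, rfl⟩,
      subset_closure ⟨p, hp, rfl⟩⟩, rfl⟩
  · simp only [q, Coeffs.eval_comp, hT0, hS0]
  · simp only [q, Coeffs.eval_comp, hT1, hS1, Function.comp_apply]
  · have : (fun x => ((S (q (x, u))).comp (T (x, u))).eval x) =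
        (fun y => (S (y, u)).eval y) ∘ fun x => (T (x, u)).eval x := by
      funext x
      simp only [q, Coeffs.eval_comp, Function.comp_apply]
    rw [this, image_comp, hTi, hSi]

theorem image_plus_ne_zero_eq {f : E n → E n} (hf : Function.Surjective f)
    (h : ∀ x, (f x).plus = 0 ↔ x.plus = 0) : f '' {x | x.plus ≠ 0} = {x | x.plus ≠ 0} := by
  have : {x : E n | x.plus ≠ 0} = f ⁻¹' {x | x.plus ≠ 0} := by
    ext x
    exact (not_congr (h x)).symm
  nth_rewrite 1 [this]
  exact image_preimage_eq _ hf

/-- Along the straight-line homotopy the scalar `1 - u + u ε` stays positive, and the translation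
does not affect `x⁺`. -/
theorem isAdmissible_affine {ε : ℝ} (hε : 0 < ε) {y : E n} (hy : y.plus = 0) :
    IsAdmissible fun x : E n => ε • x + y := by
  have hpos : ∀ u : unitInterval, 0 < 1 - (u : ℝ) + u * ε := fun u => by
    rcases u.2.1.eq_or_lt with h | h
    · rw [← h]; simp
    · have := u.2.2
      have := mul_pos h hε
      linarith
  let α : E n × unitInterval → Ioi (0 : ℝ) := fun p => ⟨1 - (p.2 : ℝ) + p.2 * ε, hpos p.2⟩
  have hα : Continuous α := Continuous.subtype_mk (by fun_prop) _
  have heval : ∀ x u, Coeffs.eval (α (x, u), α (x, u), α (x, u), (u : ℝ) • y) x =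
      (1 - (u : ℝ) + u * ε) • x + (u : ℝ) • y := fun x u => by
    simp only [Coeffs.eval, α, ← smul_add, plus_add_zero_add_minus]
  refine isAdmissible_iff.2 ⟨fun p => (α p, α p, α p, (p.2 : ℝ) • y), by fun_prop, fun B _ => ?_,
    fun x => ?_, fun x => ?_, fun u => ?_⟩
  · refine Coeffs.isCompact_closure_of_subset (l := min 1 ε) (u := max 1 ε)
      (K := (fun u : ℝ => u • y) '' Icc 0 1) (lt_min one_pos hε)
      (isCompact_Icc.image (by fun_prop)) fun p _ => ?_
    have h0 := p.2.2.1
    have h1 := p.2.2.2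
    have hI : 1 - (p.2 : ℝ) + p.2 * ε ∈ Icc (min 1 ε) (max 1 ε) := by
      have h2 := min_le_left 1 ε
      have h3 := min_le_right 1 ε
      have h4 := le_max_left 1 ε
      have h5 := le_max_right 1 ε
      constructor <;> nlinarith
    exact ⟨hI, hI, hI, mem_image_of_mem _ p.2.2⟩
  · rw [heval]; simp
  · rw [heval]; simp
  · simp only [heval]
    refine image_plus_ne_zero_eq (fun z => ⟨(1 - (u : ℝ) + u * ε)⁻¹ • (z - (u : ℝ) • y), ?_⟩)
      fun x => ?_
    · simp only [smul_inv_smul₀ (hpos u).ne', sub_add_cancel]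
    · rw [plus_add, plus_smul, plus_smul, hy, smul_zero, add_zero, smul_eq_zero]
      exact or_iff_right (hpos u).ne'

/-! ### Lower bound, cutoff and gradient step -/

namespace AsymptoticallyQuadratic

variable {H : Phase n → ℝ} {g : Phase n → Phase n} {M : ℝ≥0} {C a : ℝ}

/-- If `H` vanishes near a point of `L₀`, then `Φ_H` is bounded away from `0` on an admissible
image of `S⁺`. -/
theorem exists_isAdmissible_le_action (h : AsymptoticallyQuadratic H g M C a)
    (hvanish : (interior (H ⁻¹' {0}) ∩ (L0 n : Set (Phase n))).Nonempty) :
    ∃ β : ℝ, 0 < β ∧ ∃ γ : E n → E n, IsAdmissible γ ∧ ∀ x ∈ γ '' Splus n, β ≤ action H x := by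
  obtain ⟨z, hz, hzL⟩ := hvanish
  obtain ⟨r, hr, hball⟩ := Metric.isOpen_iff.1 isOpen_interior z hz
  obtain ⟨ε, hε, hint⟩ := h.exists_integral_add_smul_le (z := z) hr fun w hw => by
    have hzw : z + w ∈ H ⁻¹' {0} :=
      interior_subset (hball (show z + w ∈ Metric.ball z r by simpa using hw))
    exact hzw
  let y : E n := single 0 ⟨z, hzL⟩
  have hyp : y.plus = 0 := ext_coef fun j => by
    rw [coef_zero, plus, coef_part]
    by_cases hj : 0 < j
    · simp [hj, y, coef_single, hj.ne]
    · simp [hj]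
  have hym : y.minus = 0 := ext_coef fun j => by
    rw [coef_zero, minus, coef_part]
    by_cases hj : j < 0
    · simp [hj, y, coef_single, hj.ne']
    · simp [hj]
  -- The quadratic part contributes `ε² / 2`, of which the integral takes at most half.
  refine ⟨ε ^ 2 / 4, by positivity, fun x => ε • x + y, isAdmissible_affine hε hyp, ?_⟩
  rintro _ ⟨x, ⟨hx, hx1⟩, rfl⟩
  have hxp : x.plus = x := plus_eq_self_iff.2 hx
  have hxm : x.minus = 0 := by rw [← hxp, minus_plus]
  have e1 : (ε • x + y).plus = ε • x := by rw [plus_add, plus_smul, hyp, hxp, add_zero]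
  have e2 : (ε • x + y).minus = 0 := by
    rw [minus_add, minus_smul, hym, hxm, smul_zero, add_zero]
  have e3 : ∫ t, H ((ε • x + y).toL2 t) = ∫ t, H (z + ε • x.toL2 t) := by
    refine integral_congr_ae ?_
    have : toL2 (ε • x + y) = ε • toL2 x + mode n 0 z := by
      rw [map_add, map_smul]; rfl
    rw [this]
    filter_upwards [Lp.coeFn_add (ε • toL2 x) (mode n 0 z), Lp.coeFn_smul ε (toL2 x),
      mode_coeFn n 0 z] with t h1 h2 h3
    rw [h1, Pi.add_apply, h2, h3, Pi.smul_apply, add_comm]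
    simp [rot]
  have h1 := hint x hx1.le
  simp only [action]
  rw [e1, e2, e3, norm_smul, hx1, norm_zero, mul_one, Real.norm_of_nonneg hε.le]
  linarith

/-- At a positive level `½‖x⁺‖²` dominates both `½‖x⁻‖²` and `∫ H`, and the latter controls `x⁰` up
to a constant. The cutoff is therefore bounded below there. -/
theorem exists_le_norm_plus (h : AsymptoticallyQuadratic H g M C a) {c : ℝ} (hc : 0 < c) :
    ∃ κ : ℝ, 0 < κ ∧ ∀ x : E n, c ≤ action H x → κ * (1 + ‖x‖) ≤ ‖x.plus‖ := by
  have hC := h.const_nonneg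
  set D : ℝ := (1 + 2 * C) / c + 4 with hD
  have hD0 : 0 < D := by positivity
  refine ⟨(Real.sqrt D)⁻¹, by positivity, fun x hx => ?_⟩
  have h1 := h.integral_nonneg (toL2 x)
  have h2 := h.le_integral (toL2 x)
  have h3 := norm_zero_le_toL2 x
  have h4 := norm_sq_eq x
  have h5 := Real.pi_gt_three
  have h6 := sq_nonneg ‖x.minus‖
  have h7 := sq_nonneg ‖toL2 x‖
  rw [action] at hx
  have h8 : 2 * c ≤ ‖x.plus‖ ^ 2 := by linarith
  have h9 : ‖x‖ ^ 2 ≤ 2 * ‖x.plus‖ ^ 2 + 2 * C := by nlinarith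
  have h10 : (1 + 2 * C) * 2 ≤ (1 + 2 * C) / c * ‖x.plus‖ ^ 2 := by
    rw [div_mul_eq_mul_div, le_div_iff₀ hc]
    nlinarith
  have h11 : (1 + ‖x‖) ^ 2 ≤ D * ‖x.plus‖ ^ 2 := by
    rw [hD, add_mul]
    nlinarith [sq_nonneg (1 - ‖x‖)]
  rw [inv_mul_le_iff₀ (Real.sqrt_pos.2 hD0)]
  refine (sq_le_sq₀ (by positivity) (by positivity)).1 ?_
  rw [mul_pow, Real.sq_sqrt hD0.le]
  exact h11

/-- The cutoff `‖x⁺‖ / (1 + ‖x‖)`. -/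
noncomputable def cutoff (x : E n) : ℝ := ‖x.plus‖ / (1 + ‖x‖)

theorem cutoff_nonneg (x : E n) : 0 ≤ cutoff x := by unfold cutoff; positivity

theorem cutoff_le_one (x : E n) : cutoff x ≤ 1 := by
  unfold cutoff
  rw [div_le_one (by positivity)]
  linarith [norm_plus_le x]

/-- The variation of the cutoff decays like `1 / (1 + ‖y‖)`, which compensates the linear growth of
the gradient. -/
theorem abs_cutoff_sub_mul_le (x y : E n) :
    |cutoff x - cutoff y| * (1 + ‖y‖) ≤ 2 * ‖x - y‖ := by
  have hx : 0 < 1 + ‖x‖ := by positivity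
  have hy : 0 < 1 + ‖y‖ := by positivity
  have e : (cutoff x - cutoff y) * (1 + ‖y‖) =
      cutoff x * (‖y‖ - ‖x‖) + (‖x.plus‖ - ‖y.plus‖) := by
    unfold cutoff
    field_simp
    ring
  rw [← abs_of_pos hy, ← abs_mul, e]
  have h1 : |‖y‖ - ‖x‖| ≤ ‖x - y‖ := by
    rw [norm_sub_rev]; exact abs_norm_sub_norm_le y x
  have h2 : |‖x.plus‖ - ‖y.plus‖| ≤ ‖x - y‖ := by
    refine (abs_norm_sub_norm_le _ _).trans ?_
    rw [← plus_sub]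
    exact norm_plus_le _
  refine (abs_add_le _ _).trans ?_
  rw [abs_mul, abs_of_nonneg (cutoff_nonneg x), two_mul]
  exact add_le_add ((mul_le_of_le_one_left (abs_nonneg _) (cutoff_le_one x)).trans h1) h2

theorem continuous_cutoff : Continuous (cutoff : E n → ℝ) := by
  unfold cutoff
  exact continuous_plus.norm.div (by fun_prop) fun x => by positivity

theorem lipschitz_cutoff_smul_grad (h : AsymptoticallyQuadratic H g M C a) :
    LipschitzWith (M + 2 + 2 * (‖h.gradAction 0‖₊ + M + 2))
      fun x => cutoff x • h.gradAction x := by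
  refine LipschitzWith.of_dist_le_mul fun x y => ?_
  have e : cutoff x • h.gradAction x - cutoff y • h.gradAction y =
      cutoff x • (h.gradAction x - h.gradAction y) + (cutoff x - cutoff y) • h.gradAction y := by
    module
  have h1 := h.norm_gradAction_sub_le x y
  have h2 : ‖h.gradAction y‖ ≤ (‖h.gradAction 0‖ + M + 2) * (1 + ‖y‖) := by
    have h3 := h.norm_gradAction_sub_le y 0
    have h4 := norm_le_norm_add_norm_sub' (h.gradAction y) (h.gradAction 0)
    rw [sub_zero] at h3
    have h5 := mul_nonneg (norm_nonneg (h.gradAction 0)) (norm_nonneg y)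
    have h6 : (0 : ℝ) ≤ M := M.2
    nlinarith
  rw [dist_eq_norm, dist_eq_norm, e]
  refine (norm_add_le _ _).trans ?_
  rw [norm_smul, norm_smul, Real.norm_of_nonneg (cutoff_nonneg x), Real.norm_eq_abs]
  have h3 : cutoff x * ‖h.gradAction x - h.gradAction y‖ ≤ (M + 2) * ‖x - y‖ :=
    (mul_le_of_le_one_left (norm_nonneg _) (cutoff_le_one x)).trans h1
  have h4 : |cutoff x - cutoff y| * ‖h.gradAction y‖ ≤
      2 * (‖h.gradAction 0‖ + M + 2) * ‖x - y‖ := by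
    calc |cutoff x - cutoff y| * ‖h.gradAction y‖
        ≤ |cutoff x - cutoff y| * ((‖h.gradAction 0‖ + M + 2) * (1 + ‖y‖)) :=
          mul_le_mul_of_nonneg_left h2 (abs_nonneg _)
      _ = (‖h.gradAction 0‖ + M + 2) * (|cutoff x - cutoff y| * (1 + ‖y‖)) := by ring
      _ ≤ (‖h.gradAction 0‖ + M + 2) * (2 * ‖x - y‖) :=
          mul_le_mul_of_nonneg_left (abs_cutoff_sub_mul_le x y) (by positivity)
      _ = _ := by ring
  push_cast
  linarith

/-- An explicit Euler step of the gradient flow of `Φ_H`, cut off along `𝔼⁻ ⊕ 𝔼⁰`. -/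
noncomputable def gradStep (h : AsymptoticallyQuadratic H g M C a) (s : ℝ) (x : E n) : E n :=
  x + s • cutoff x • h.gradAction x

theorem gradStep_bijective (h : AsymptoticallyQuadratic H g M C a) {s : ℝ} (hs : 0 ≤ s)
    (hs1 : s * (M + 2 + 2 * (‖h.gradAction 0‖ + M + 2)) < 1) :
    Function.Bijective (h.gradStep s) := by
  refine bijective_id_add_of_lipschitz
    (c := s.toNNReal * (M + 2 + 2 * (‖h.gradAction 0‖₊ + M + 2))) ?_ ?_
  · rw [← NNReal.coe_lt_coe]
    push_cast
    rwa [Real.coe_toNNReal _ hs]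
  · refine LipschitzWith.of_dist_le_mul fun x y => ?_
    rw [dist_smul₀, Real.norm_of_nonneg hs, NNReal.coe_mul, Real.coe_toNNReal _ hs, mul_assoc]
    exact mul_le_mul_of_nonneg_left (h.lipschitz_cutoff_smul_grad.dist_le_mul x y) hs

/-- The cutoff vanishes on `𝔼⁻ ⊕ 𝔼⁰`, so the step fixes this subspace pointwise; by injectivity no
other point is sent into it. -/
theorem image_gradStep (h : AsymptoticallyQuadratic H g M C a) {s : ℝ} (hs : 0 ≤ s)
    (hs1 : s * (M + 2 + 2 * (‖h.gradAction 0‖ + M + 2)) < 1) :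
    h.gradStep s '' {x | x.plus ≠ 0} = {x | x.plus ≠ 0} := by
  have hfix : ∀ x : E n, x.plus = 0 → h.gradStep s x = x := fun x hx => by
    simp [gradStep, cutoff, hx]
  have hbij := h.gradStep_bijective hs hs1
  refine image_plus_ne_zero_eq hbij.2 fun x => ⟨fun hx => ?_, fun hx => ?_⟩
  · rwa [hbij.1 (hfix _ hx)] at hx
  · rwa [hfix x hx]

/-- With `τ = u s χ(x)` the step at time `u` reads `(1 + τ) x⁺ + x⁰ + (1 - τ) x⁻ - τ κ(x)`, where
`κ` is compact. The bound `s ≤ 1/2` keeps `1 - τ` away from `0`. -/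
theorem isAdmissible_gradStep (h : AsymptoticallyQuadratic H g M C a) {s : ℝ} (hs : 0 ≤ s)
    (hs2 : s ≤ 1 / 2) (hs1 : s * (M + 2 + 2 * (‖h.gradAction 0‖ + M + 2)) < 1) :
    IsAdmissible (h.gradStep s) := by
  let τ : E n × unitInterval → ℝ := fun p => p.2 * s * cutoff p.1
  have hτ : Continuous τ := by
    have := continuous_cutoff (n := n)
    fun_prop
  have hτ0 : ∀ p, 0 ≤ τ p := fun p =>
    mul_nonneg (mul_nonneg p.2.2.1 hs) (cutoff_nonneg p.1)
  have hτ1 : ∀ p, τ p ≤ 1 / 2 := fun p => by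
    have h1 : p.2 * s ≤ 1 / 2 := (mul_le_of_le_one_left hs p.2.2.2).trans hs2
    exact (mul_le_of_le_one_right (mul_nonneg p.2.2.1 hs) (cutoff_le_one p.1)).trans h1
  let κ : E n → E n := fun x => adjL n (h.gradL2 (toL2 x))
  have hκ : Continuous κ := by
    have : κ = fun x => x.plus - x.minus - h.gradAction x := by
      funext x
      simp only [κ, gradAction]
      abel
    rw [this]
    exact (continuous_plus.sub continuous_minus).sub h.continuous_gradAction
  let T : E n × unitInterval → Coeffs n := fun p =>
    (⟨1 + τ p, by have := hτ0 p; simp only [mem_Ioi]; linarith⟩, ⟨1, mem_Ioi.2 one_pos⟩,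
      ⟨1 - τ p, by have := hτ1 p; simp only [mem_Ioi]; linarith⟩, -(τ p • κ p.1))
  have heval : ∀ x u, (T (x, u)).eval x = h.gradStep (u * s) x := fun x u => by
    simp only [T, Coeffs.eval, gradStep, gradAction, τ, κ]
    conv_rhs => lhs; rw [← plus_add_zero_add_minus x]
    module
  refine isAdmissible_iff.2 ⟨T, ?_, fun B hB => ?_, fun x => ?_, fun x => ?_, fun u => ?_⟩
  · exact Continuous.prodMk (Continuous.subtype_mk (by fun_prop) _) (Continuous.prodMk
      continuous_const (Continuous.prodMk (Continuous.subtype_mk (by fun_prop) _)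
        (hτ.smul (hκ.comp continuous_fst)).neg))
  · obtain ⟨r, hr⟩ := (Bornology.isBounded_image_fst_and_snd.2 hB).1.exists_norm_le
    obtain ⟨K, hK, hKs⟩ := (isCompactOperator_adjL (n := n)).image_closedBall_subset_compact
      (f := (adjL n : L2Loop n →ₗ[ℝ] E n)) (M * r + ‖h.gradL2 0‖)
    refine Coeffs.isCompact_closure_of_subset (l := 1 / 2) (u := 2)
      (K := (fun q : ℝ × E n => -(q.1 • q.2)) '' (Icc 0 (1 / 2) ×ˢ K)) (by norm_num)
      ((isCompact_Icc.prod hK).image (by fun_prop)) fun p hp => ?_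
    have h0 := hτ0 p
    have h1 := hτ1 p
    refine ⟨⟨?_, ?_⟩, ⟨?_, ?_⟩, ⟨?_, ?_⟩, ?_⟩
    · simp only [T]; linarith
    · simp only [T]; linarith
    · simp only [T]; norm_num
    · simp only [T]; norm_num
    · simp only [T]; linarith
    · simp only [T]; linarith
    · refine ⟨(τ p, κ p.1), ⟨⟨h0, h1⟩, hKs ⟨_, ?_, rfl⟩⟩, rfl⟩
      rw [mem_closedBall_zero_iff]
      have h2 := h.norm_gradL2_sub_le (toL2 p.1) 0
      rw [sub_zero] at h2
      have h3 := norm_le_norm_add_norm_sub' (h.gradL2 (toL2 p.1)) (h.gradL2 0)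
      have h4 : ‖toL2 p.1‖ ≤ r := (norm_toL2_le _).trans (hr _ (mem_image_of_mem _ hp))
      have h5 := mul_le_mul_of_nonneg_left h4 (NNReal.coe_nonneg M)
      linarith
  · rw [heval]; simp [gradStep]
  · rw [heval]; simp
  · simp only [heval]
    have h0 := u.2.1
    have h1 := u.2.2
    refine h.image_gradStep (mul_nonneg h0 hs) (lt_of_le_of_lt ?_ hs1)
    exact mul_le_mul_of_nonneg_right (mul_le_of_le_one_left hs h1) (by positivity)

/-- The first-order gain is `s χ ‖∇Φ‖²`; for small `s` and `χ ≤ 1` the quadratic error consumes at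
most half of it. -/
theorem le_action_gradStep (h : AsymptoticallyQuadratic H g M C a) {s : ℝ} (hs : 0 ≤ s)
    (hs1 : s * (M + 1) ≤ 1 / 2) (x : E n) :
    action H x + s * cutoff x * ‖h.gradAction x‖ ^ 2 / 2 ≤ action H (h.gradStep s x) := by
  have h1 := (abs_le.1 (h.abs_action_add_sub_le x (s • cutoff x • h.gradAction x))).1
  rw [real_inner_smul_right, real_inner_smul_right, real_inner_self_eq_norm_sq, norm_smul,
    norm_smul, Real.norm_of_nonneg hs, Real.norm_of_nonneg (cutoff_nonneg x)] at h1
  have h0 := cutoff_nonneg x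
  have h2 : (M + 1) * (s * (cutoff x * ‖h.gradAction x‖)) ^ 2 ≤
      s * cutoff x * ‖h.gradAction x‖ ^ 2 / 2 := by
    have h3 : s * (M + 1) * cutoff x ≤ 1 / 2 :=
      (mul_le_of_le_one_right (by positivity) (cutoff_le_one x)).trans hs1
    have h4 : 0 ≤ s * cutoff x * ‖h.gradAction x‖ ^ 2 := by positivity
    calc (M + 1) * (s * (cutoff x * ‖h.gradAction x‖)) ^ 2
        = s * (M + 1) * cutoff x * (s * cutoff x * ‖h.gradAction x‖ ^ 2) := by ring
      _ ≤ 1 / 2 * (s * cutoff x * ‖h.gradAction x‖ ^ 2) := mul_le_mul_of_nonneg_right h3 h4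
      _ = _ := by ring
  rw [gradStep]
  linarith

end AsymptoticallyQuadratic

end SymEH

/-! ### Intersection of admissible images with a half-space -/

namespace SymEH

open scoped NNReal
open Filter Topology
open E

variable {n : ℕ}

theorem E.tendsto_part_of_tendsto {A : ℕ → Set ℤ} {y : ℕ → E n} {z w : E n}
    (hy : Tendsto y atTop (𝓝 z)) (hz : Tendsto (fun k => z.part (A k)) atTop (𝓝 w)) :
    Tendsto (fun k => (y k).part (A k)) atTop (𝓝 w) := by
  have h1 : Tendsto (fun k => (y k).part (A k) - z.part (A k)) atTop (𝓝 0) := by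
    refine squeeze_zero_norm (a := fun k => ‖y k - z‖) (fun k => ?_)
      (tendsto_iff_norm_sub_tendsto_zero.1 hy)
    have : (y k).part (A k) - z.part (A k) = (y k - z).part (A k) :=
      (map_sub (partL n (A k)) (y k) z).symm
    rw [this]
    exact norm_part_le _ _
  have h2 := h1.add hz
  rw [_root_.zero_add] at h2
  exact h2.congr fun k => sub_add_cancel _ _

/-- The modes `1, …, N`. -/
def posModes (N : ℕ) : Set ℤ := Icc (-N : ℤ) N ∩ {j | 0 < j}

instance (N : ℕ) : Finite (posModes N) := ((finite_Icc (-N : ℤ) N).inter_of_left _)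

theorem part_posModes (N : ℕ) (x : E n) : x.part (posModes N) = x.plus.part (Icc (-N : ℤ) N) := by
  rw [posModes, plus, part_part]

theorem part_eq_self {A : Set ℤ} {x : E n} (hx : x ∈ supportedOn n A) : x.part A = x := by
  refine ext_coef fun j => ?_
  by_cases hj : j ∈ A
  · exact coef_part_of_mem x hj
  · rw [coef_part_of_notMem x hj, hx j hj]

theorem single_mem_supportedOn {A : Set ℤ} {j : ℤ} (hj : j ∈ A) (v : L0 n) :
    single j v ∈ supportedOn n A := fun k hk => by
  rw [coef_single, if_neg]
  rintro rfl
  exact hk hj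

theorem single_ne_zero (j : ℤ) {v : L0 n} (hv : v ≠ 0) : single j v ≠ 0 := fun h0 => by
  have h := norm_single_sq (n := n) j v
  rw [h0, norm_zero, zero_pow two_ne_zero, eq_comm, mul_eq_zero] at h
  exact h.elim (weight_pos j).ne' fun h => hv (by simpa using h)

theorem supportedOn_posModes_le (N : ℕ) : supportedOn n (posModes N) ≤ Eplus n :=
  fun _ hx j hj => hx j fun h => hj h.2

theorem Coeffs.eval_of_mem_Eplus (T : Coeffs n) {x : E n} (hx : x ∈ Eplus n) :
    T.eval x = (T.1 : ℝ) • x + T.2.2.2 := by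
  have h := plus_eq_self_iff.2 hx
  have h0 : x.zero = 0 := by rw [← h, zero_plus]
  have h1 : x.minus = 0 := by rw [← h, minus_plus]
  rw [Coeffs.eval, h, h0, h1, smul_zero, smul_zero, add_zero, add_zero]

/-- The Galerkin approximation of `IsAdmissible.exists_plus_eq_smul`. -/
theorem exists_part_eval_eq_smul {T : E n × unitInterval → Coeffs n} (hT : Continuous T)
    (hT0 : ∀ x, (T (x, 0)).eval x = x) {v : L0 n} (hv : v ≠ 0) (N : ℕ) :
    ∃ x ∈ supportedOn n (posModes (N + 1)), ‖x‖ = 1 ∧ ∃ (u : unitInterval) (s : ℝ), 0 ≤ s ∧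
      s * (1 - u) = 0 ∧ ((T (x, u)).eval x).part (posModes (N + 1)) = s • single 1 v := by
  -- The condition `s (1 - u) = 0` merges two outcomes: the truncated homotopy has a zero (`s = 0`,
  -- any `u`), or its end map meets the ray (`u = 1`). Zeros cannot be excluded yet, because
  -- truncation may destroy condition (i). The index `N + 1` ensures that mode `1` is present.
  by_contra! hcon
  let A := posModes (N + 1)
  have h1A : (1 : ℤ) ∈ A := ⟨⟨by push_cast; omega, by push_cast; omega⟩, by simp⟩
  let V := supportedOn n A
  let f : V × ℝ → V := fun p =>
    ⟨((T ((p.1 : E n), projIcc 0 1 zero_le_one p.2)).eval p.1).part A, part_mem_supportedOn A _⟩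
  have hf : Continuous f := by
    refine Continuous.subtype_mk ((partL n A).continuous.comp ?_) _
    refine Coeffs.continuous_eval.comp₂ (hT.comp ?_) (by fun_prop)
    exact (continuous_subtype_val.comp continuous_fst).prodMk
      (continuous_projIcc.comp continuous_snd)
  have hf0 : ∀ x : V, ‖x‖ = 1 → f (x, 0) = x := fun x _ => by
    refine Subtype.ext ?_
    have h : projIcc (0 : ℝ) 1 zero_le_one 0 = 0 := projIcc_left _
    simp only [f, h, hT0]
    exact part_eq_self x.2
  have hfne : ∀ x : V, ‖x‖ = 1 → ∀ u ∈ Icc (0 : ℝ) 1, f (x, u) ≠ 0 := fun x hx u hu h0 => by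
    refine hcon x x.2 hx ⟨u, hu⟩ 0 le_rfl (zero_mul _) ?_
    have h := congrArg Subtype.val h0
    simp only [f, projIcc_of_mem zero_le_one hu] at h
    rw [_root_.zero_smul]
    exact h
  let e : V := ⟨single 1 v, single_mem_supportedOn h1A v⟩
  have he : e ≠ 0 := fun h0 => single_ne_zero 1 hv (congrArg Subtype.val h0)
  obtain ⟨x, hx, s, hs, hxs⟩ := exists_mem_ray_of_homotopy hf hf0 hfne he
  refine hcon x x.2 hx 1 s hs (by simp) ?_
  have h := congrArg Subtype.val hxs
  simpa [f] using h

/-- Every admissible image of `S⁺` meets `𝔼⁻ ⊕ 𝔼⁰ ⊕ ℝ_{≥ 0} e`, where `e` is the loop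
`t ↦ e^{2πtJ₀} v`. -/
theorem IsAdmissible.exists_plus_eq_smul {γ : E n → E n} (hγ : IsAdmissible γ) {v : L0 n}
    (hv : v ≠ 0) : ∃ x ∈ Splus n, ∃ s : ℝ, 0 ≤ s ∧ (γ x).plus = s • single 1 v := by
  obtain ⟨T, hT, hTB, hT0, hT1, himg⟩ := isAdmissible_iff.1 hγ
  choose x hxA hx1 u s hs hsu hxs using fun N => exists_part_eval_eq_smul hT hT0 hv N
  set e : E n := single 1 v
  have hxP : ∀ N, x N ∈ Eplus n := fun N => supportedOn_posModes_le _ (hxA N)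
  have he0 : 0 < ‖e‖ := norm_pos_iff.2 (single_ne_zero 1 hv)
  let B : Set (E n × unitInterval) := Metric.sphere 0 1 ×ˢ univ
  have hB : Bornology.IsBounded B := Metric.isBounded_sphere.prod (isCompact_univ.isBounded)
  have hxB : ∀ N, (x N, u N) ∈ B := fun N => ⟨by simpa using hx1 N, mem_univ _⟩
  have hTc := hTB B hB
  obtain ⟨R, hR⟩ := (Coeffs.isBounded_eval hTc
    (Bornology.isBounded_image_fst_and_snd.2 hB).1).exists_norm_le
  have hsR : ∀ N, s N ∈ Icc 0 (R / ‖e‖) := fun N => by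
    refine ⟨hs N, ?_⟩
    rw [le_div_iff₀ he0]
    have h1 := congrArg norm (hxs N)
    rw [norm_smul, Real.norm_of_nonneg (hs N)] at h1
    rw [← h1]
    exact (norm_part_le _ _).trans (hR _ ⟨_, hxB N, rfl⟩)
  obtain ⟨⟨T₀, u₀, s₀⟩, -, φ, hφ, hlim⟩ :=
    (hTc.prod ((isCompact_univ (X := unitInterval)).prod
      (isCompact_Icc (a := (0 : ℝ)) (b := R / ‖e‖)))).tendsto_subseq
      (x := fun N => (T (x N, u N), u N, s N))
      fun N => ⟨subset_closure ⟨_, hxB N, rfl⟩, mem_univ _, hsR N⟩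
  have hTl : Tendsto (fun k => T (x (φ k), u (φ k))) atTop (𝓝 T₀) :=
    (continuous_fst.tendsto _).comp hlim
  have hul : Tendsto (fun k => u (φ k)) atTop (𝓝 u₀) :=
    ((continuous_fst.comp continuous_snd).tendsto _).comp hlim
  have hsl : Tendsto (fun k => s (φ k)) atTop (𝓝 s₀) :=
    ((continuous_snd.comp continuous_snd).tendsto _).comp hlim
  have hal : Tendsto (fun k => ((T (x (φ k), u (φ k))).1 : ℝ)) atTop (𝓝 (T₀.1 : ℝ)) :=
    ((continuous_subtype_val.comp continuous_fst).tendsto T₀).comp hTl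
  have hKl : Tendsto (fun k => (T (x (φ k), u (φ k))).2.2.2) atTop (𝓝 T₀.2.2.2) :=
    ((by fun_prop : Continuous fun S : Coeffs n => S.2.2.2).tendsto T₀).comp hTl
  have hpart : Tendsto (fun k => ((T (x (φ k), u (φ k))).2.2.2).part (posModes (φ k + 1))) atTop
      (𝓝 T₀.2.2.2.plus) := by
    refine tendsto_part_of_tendsto hKl ?_
    simp only [part_posModes]
    exact (tendsto_part T₀.2.2.2.plus).comp
      ((tendsto_add_atTop_nat 1).comp hφ.tendsto_atTop)
  have ha0 : (T₀.1 : ℝ) ≠ 0 := (mem_Ioi.1 T₀.1.2).ne'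
  -- Solving the truncated equation for `x k` expresses it by quantities that converge along the
  -- subsequence, so the points on the infinite-dimensional sphere converge too.
  have hxeq : ∀ k, x k = ((T (x k, u k)).1 : ℝ)⁻¹ •
      (s k • e - ((T (x k, u k)).2.2.2).part (posModes (k + 1))) := fun k => by
    have h1 := hxs k
    rw [Coeffs.eval_of_mem_Eplus _ (hxP k), ← partL_apply, map_add, map_smul, partL_apply,
      partL_apply, part_eq_self (hxA k)] at h1
    rw [← h1, add_sub_cancel_right, inv_smul_smul₀ (mem_Ioi.1 (T (x k, u k)).1.2).ne']
  set x₀ : E n := (T₀.1 : ℝ)⁻¹ • (s₀ • e - T₀.2.2.2.plus) with hx₀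
  have hxl : Tendsto (fun k => x (φ k)) atTop (𝓝 x₀) := by
    have h1 := (hal.inv₀ ha0).smul ((hsl.smul_const e).sub hpart)
    exact h1.congr fun k => (hxeq (φ k)).symm
  have hx₀P : x₀ ∈ Eplus n := by
    refine plus_eq_self_iff.1 (tendsto_nhds_unique ((continuous_plus.tendsto x₀).comp hxl) ?_)
    exact hxl.congr fun k => (plus_eq_self_iff.2 (hxP (φ k))).symm
  have hx₀1 : ‖x₀‖ = 1 := by
    refine tendsto_nhds_unique hxl.norm ?_
    simp only [hx1]
    exact tendsto_const_nhds
  have hT₀ : T₀ = T (x₀, u₀) :=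
    tendsto_nhds_unique hTl ((hT.tendsto (x₀, u₀)).comp (hxl.prodMk_nhds hul))
  have hs₀ : 0 ≤ s₀ := ge_of_tendsto' hsl fun k => hs _
  have hsu₀ : s₀ * (1 - u₀) = 0 := by
    have h1 : Tendsto (fun k => (u (φ k) : ℝ)) atTop (𝓝 (u₀ : ℝ)) :=
      (continuous_subtype_val.tendsto u₀).comp hul
    refine tendsto_nhds_unique (hsl.mul (h1.const_sub 1)) ?_
    simp only [hsu]
    exact tendsto_const_nhds
  have heval : ((T (x₀, u₀)).eval x₀).plus = s₀ • e := by
    rw [← hT₀, Coeffs.eval_of_mem_Eplus _ hx₀P, plus_add, plus_smul, plus_eq_self_iff.2 hx₀P,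
      hx₀, smul_inv_smul₀ ha0, sub_add_cancel]
  -- In the limit the full positive part is present, so `s₀ = 0` contradicts the invariance of `{x⁺
  -- ≠ 0}`. Only `u₀ = 1` remains.
  rcases mul_eq_zero.1 hsu₀ with h0 | h0
  · exfalso
    rw [h0, _root_.zero_smul] at heval
    have h1 : (T (x₀, u₀)).eval x₀ ∈ {x : E n | x.plus ≠ 0} := by
      rw [← himg u₀]
      refine ⟨x₀, ?_, rfl⟩
      intro h2
      rw [plus_eq_self_iff.2 hx₀P] at h2
      rw [h2, norm_zero] at hx₀1
      exact zero_ne_one hx₀1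
    exact h1 heval
  · have h1 : u₀ = 1 := Subtype.ext (sub_eq_zero.1 h0).symm
    rw [h1, hT1] at heval
    exact ⟨x₀, ⟨hx₀P, hx₀1⟩, s₀, hs₀, heval⟩

/-! ### Upper bound and deformation at a regular level -/

namespace AsymptoticallyQuadratic

variable {H : Phase n → ℝ} {g : Phase n → Phase n} {M : ℝ≥0} {C a : ℝ}

/-- Here `½‖x⁺‖² = π |x₁|²`, while `∫ H ≥ 2π‖x‖²_{L²} - C ≥ 2π |x₁|² - C`. -/
theorem action_le_of_plus_eq_smul (h : AsymptoticallyQuadratic H g M C a) {x : E n} {s : ℝ}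
    {v : L0 n} (hx : x.plus = s • single 1 v) : action H x ≤ C := by
  have h1 : x.coef 1 = s • (v : Phase n) := by
    have h2 : x.plus.coef 1 = x.coef 1 := coef_part_of_mem x (by simp)
    rw [← h2, hx, coef_smul, coef_single, if_pos rfl]
  have h3 := le_hasSum (hasSum_norm_sq_toL2 x) 1 fun _ _ => sq_nonneg _
  have h4 := h.le_integral (toL2 x)
  have h5 : ‖x.plus‖ ^ 2 = 2 * Real.pi * ‖x.coef 1‖ ^ 2 := by
    rw [hx, h1, norm_smul, norm_smul, mul_pow, norm_single_sq, weight_of_ne one_ne_zero]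
    simp only [Int.cast_one, abs_one]
    ring
  have h6 := sq_nonneg ‖x.minus‖
  have h7 := Real.pi_pos
  have h8 := mul_le_mul_of_nonneg_left h3 Real.two_pi_pos.le
  have h9 : 0 ≤ Real.pi * ‖x.coef 1‖ ^ 2 := by positivity
  rw [action, h5]
  linarith

theorem cEH_le (h : AsymptoticallyQuadratic H g M C a) (hn : 0 < n) : cEH H ≤ (C : EReal) := by
  let v : L0 n := ⟨EuclideanSpace.single (Sum.inl ⟨0, hn⟩) (1 : ℝ), by
    change tau0 n _ = _
    ext i
    rcases i with i | i <;> simp [tau0]⟩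
  have hv : v ≠ 0 := fun h0 => by
    have h1 := congrArg (fun w : L0 n => ‖(w : Phase n)‖) h0
    simp [v] at h1
  refine iSup₂_le fun γ hγ => ?_
  obtain ⟨x, hx, s, -, hxs⟩ := IsAdmissible.exists_plus_eq_smul hγ hv
  exact iInf₂_le_of_le (γ x) ⟨x, hx, rfl⟩ (EReal.coe_le_coe_iff.2 (h.action_le_of_plus_eq_smul hxs))

/-- If `c > 0` is not a critical value and all of some admissible image of `S⁺` lies above a
level slightly below `c`, then another one lies above a level larger than `c`. -/
theorem exists_isAdmissible_gt (h : AsymptoticallyQuadratic H g M C a)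
    (ha : 2 * Real.pi < a) (hres : ∀ k : ℤ, a ≠ k * Real.pi) {c : ℝ} (hc0 : 0 < c)
    (hc : ¬ IsCriticalValue H c) :
    ∃ η : ℝ, 0 < η ∧ ∀ γ : E n → E n, IsAdmissible γ →
      (∀ x ∈ γ '' Splus n, c - η ≤ action H x) →
      ∃ γ' : E n → E n, IsAdmissible γ' ∧ ∀ x ∈ γ' '' Splus n, c + η ≤ action H x := by
  obtain ⟨ε, hε, hgrad⟩ := h.exists_le_norm_gradAction ha hres hc
  obtain ⟨κ, hκ, hplus⟩ := h.exists_le_norm_plus (c := c / 2) (by positivity)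
  set Q : ℝ := M + 2 + 2 * (‖h.gradAction 0‖ + M + 2) with hQ
  have hM0 : (0 : ℝ) ≤ M := M.2
  have hQ0 : (M : ℝ) + 2 ≤ Q := by
    rw [hQ]
    have : 0 ≤ ‖h.gradAction 0‖ := norm_nonneg _
    linarith
  -- `Q` is the Lipschitz constant of the cut-off gradient, so the perturbation of the identity
  -- contracts by `1/2`.
  set s : ℝ := 1 / (2 * Q) with hs
  have hs0 : 0 < s := by positivity
  have hsQ : s * Q = 1 / 2 := by
    have hQ1 : Q ≠ 0 := (by linarith : 0 < Q).ne'
    rw [hs]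
    field_simp
  have hs2 : s ≤ 1 / 2 := by nlinarith
  have hsM : s * (M + 1) ≤ 1 / 2 := by nlinarith
  -- The guaranteed gain of one step where `Φ_H` is within `ε` of `c` and at least `c / 2`.
  set d : ℝ := s * κ * ε ^ 2 / 2 with hd
  have hd0 : 0 < d := by positivity
  -- The three bounds on `η` keep the values in the window where the gradient is large, keep them
  -- above `c / 2`, and ensure `c - η + d ≥ c + η`.
  refine ⟨min (min (ε / 2) (c / 2)) (d / 2), by positivity, fun γ hγ hlow =>
    ⟨h.gradStep s ∘ γ, (h.isAdmissible_gradStep hs0.le hs2 (by rw [hsQ]; norm_num)).comp hγ, ?_⟩⟩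
  set η := min (min (ε / 2) (c / 2)) (d / 2)
  have hη1 : η ≤ ε / 2 := (min_le_left _ _).trans (min_le_left _ _)
  have hη2 : η ≤ c / 2 := (min_le_left _ _).trans (min_le_right _ _)
  have hη3 : η ≤ d / 2 := min_le_right _ _
  rintro _ ⟨y, hy, rfl⟩
  have hx := hlow (γ y) ⟨y, hy, rfl⟩
  rw [Function.comp_apply]
  set x := γ y
  have hstep := h.le_action_gradStep hs0.le hsM x
  have hχ0 := cutoff_nonneg x
  rcases lt_or_ge (action H x) (c + η) with hlt | hge
  · have h1 : ε ≤ ‖h.gradAction x‖ := hgrad x (by rw [abs_lt]; constructor <;> linarith)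
    have h2 : κ ≤ cutoff x := by
      rw [cutoff, le_div_iff₀ (by positivity)]
      exact hplus x (by linarith)
    have h3 : d ≤ s * cutoff x * ‖h.gradAction x‖ ^ 2 / 2 := by
      rw [hd]
      gcongr
    linarith
  · have : 0 ≤ s * cutoff x * ‖h.gradAction x‖ ^ 2 / 2 := by positivity
    linarith

end AsymptoticallyQuadratic

end SymEH

/-! ### The minimax argument -/

theorem theorem3p1 (n : ℕ) (hn : 0 < n) (H : SymEH.Phase n → ℝ)
    (hsmooth : ContDiff ℝ ∞ H)
    (hnonneg : ∀ z, 0 ≤ H z)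
    (hsymm : ∀ z, H z = H (SymEH.tau0 n z))
    (hvanish : (interior (H ⁻¹' {0}) ∩ (SymEH.L0 n : Set (SymEH.Phase n))).Nonempty)
    (hquad : SymEH.QuadraticAtInfinity H)
    (hnonres : SymEH.Nonresonant H) :
    ∃ c : ℝ, SymEH.cEH H = (c : EReal) ∧ 0 < c ∧ SymEH.IsCriticalValue H c := by
  obtain ⟨z₀, -, a, b, ha, hres, hH⟩ := hnonres
  obtain ⟨g, M, C, h⟩ := SymEH.exists_asymptoticallyQuadratic hsmooth hnonneg ha hH
  obtain ⟨β, hβ, γ₀, hγ₀, hlow₀⟩ := h.exists_isAdmissible_le_action hvanish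
  have hle : ∀ {r : ℝ} {γ : SymEH.E n → SymEH.E n}, SymEH.IsAdmissible γ →
      (∀ x ∈ γ '' SymEH.Splus n, r ≤ SymEH.action H x) → (r : EReal) ≤ SymEH.cEH H :=
    fun {r γ} hγ hr => le_iSup₂_of_le γ hγ
      (le_iInf₂ fun x hx => EReal.coe_le_coe_iff.2 (hr x hx))
  have hβc : (β : EReal) ≤ SymEH.cEH H := hle hγ₀ hlow₀
  have htop : SymEH.cEH H ≠ ⊤ := ne_top_of_le_ne_top (EReal.coe_ne_top C) (h.cEH_le hn)
  have hbot : SymEH.cEH H ≠ ⊥ := ne_bot_of_le_ne_bot (EReal.coe_ne_bot β) hβc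
  obtain ⟨c, hc⟩ : ∃ c : ℝ, SymEH.cEH H = (c : EReal) :=
    ⟨_, (EReal.coe_toReal htop hbot).symm⟩
  have hc0 : 0 < c := hβ.trans_le (EReal.coe_le_coe_iff.1 (hc ▸ hβc))
  refine ⟨c, hc, hc0, ?_⟩
  by_contra hcrit
  obtain ⟨η, hη, hdef⟩ := h.exists_isAdmissible_gt ha hres hc0 hcrit
  -- Some admissible map has infimum above `c - η`; deforming it gives one with infimum at least `c
  -- + η`, contradicting the supremum.
  have hlt : ((c - η : ℝ) : EReal) < SymEH.cEH H := by
    rw [hc]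
    exact EReal.coe_lt_coe_iff.2 (by linarith)
  obtain ⟨γ, hγlt⟩ := lt_iSup_iff.1 hlt
  obtain ⟨hγ, hγlt⟩ := lt_iSup_iff.1 hγlt
  obtain ⟨γ', hγ', hlow'⟩ := hdef γ hγ fun x hx =>
    EReal.coe_le_coe_iff.1 (hγlt.le.trans (iInf₂_le x hx))
  have h1 := hle hγ' hlow'
  rw [hc, EReal.coe_le_coe_iff] at h1
  linarith
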